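/- **Setting.** Players $i=1,\dots,N$ choose $x_i\in\mathbb R^m$. Player $i$ minimizes $f_i(x_i,x_i+\bar x_{-i})+r_i(x_i)$, where $\bar x_{-i}=\sum_{j\ne i}x_j$ and $f_i(x_i,y)=\mathbb E[\psi_i(x_i,y;\xi)]$ with a random vector $\xi\in\mathbb R^d$. Write $\bar x=\sum_j x_j$. The symbol $\nabla_{x_i}$ denotes the gradient in player $i$'s own decision, which also enters the aggregate: $\nabla_{x_i}f_i(x_i,y)$ is the gradient at $z=x_i$ of $z\mapsto f_i(z,z+(y-x_i))$, and similarly for $\psi_i$. Let $\mathcal R_i=\operatorname{dom} r_i$, $\mathcal R=\prod_i\mathcal R_i$, $\bar{\mathcal R}=\sum_i\mathcal R_i$, and let $Y\supseteq\bar{\mathcal R}$ be a set of vectors in $\mathbb R^m$ containing all the points $N\hat v_{i,k}$ at which the algorithm below evaluates gradients. Norms are Euclidean, $\|x\|^2=\sum_i\|x_i\|^2$. **Assumptions.** (a) $r_i:\mathbb R^m\to(-\infty,+\infty]$ is lower semicontinuous and convex, and $\mathcal R_i$ is compact. (b) For every $x\in\mathcal R$, $z\mapsto f_i(z,z+\bar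 x_{-i})$ is well defined (the expectation exists), $C^1$ and convex on an open set containing $\mathcal R_i$. (c) For $x_i\in\mathcal R_i$ and $y\in Y$: the own-decision gradients $\nabla_{x_i}f_i(x_i,y)$ and $\nabla_{x_i}\psi_i(x_i,y;s)$, $s\in\mathbb R^d$, exist, and $\nabla_{x_i}f_i(x_i,y)=\mathbb E[\nabla_{x_i}\psi_i(x_i,y;\xi)]$; $\nabla_{x_i}f_i$ is measurable on $\mathcal R_i\times Y$. (d) $\phi(x)=(\nabla_{x_i}f_i(x_i,\bar x))_{i=1}^N$ satisfies $(\phi(x)-\phi(y))^T(x-y)\ge\eta\|x-y\|^2$ and $\|\phi(x)-\phi(y)\|\le L\|x-y\|$ for $x,y\in\mathcal R$, with $L>0$; and $\|\nabla_{x_i}f_i(x_i,y_1)-\nabla_{x_i}f_i(x_i,y_2)\|\le L_i\|y_1-y_2\|$ for $x_i\in\mathcal R_i$, $y_1,y_2\in Y$, with $L_i\ge0$. (e) $\mathcal G$ is a connected undirected graph on the players, and $A=[a_{ij}]$ is symmetric with unit row sums, $a_{ij}>0$ if $i,j$ are neighbours, $a_{ij}=0$ if $i\neq j$ are not, and $a_{ii}\ge0$.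 **Algorithm.** Let $\theta>0$ and $\beta\in(0,1)$ be constants with $|[A^k]_{ij}-1/N|\le\theta\beta^k$ for all $i,j$ and $k\ge0$; put $\tau_k=k+1$ and $N_k=\lceil\beta^{-(k+1)/2}\rceil$. Start from $v_{i,0}=x_{i,0}\in\mathcal R_i$ (random), and for $k\ge0$ let $\hat v_{i,k}=\sum_j[A^{\tau_k}]_{ij}v_{j,k}$ ($\tau_k$ rounds of averaging over neighbours), $$x_{i,k+1}=\mathrm{prox}_{\alpha r_i}\big[x_{i,k}-\alpha(\nabla_{x_i}f_i(x_{i,k},N\hat v_{i,k})+e_{i,k})\big],\qquad e_{i,k}=\frac1{N_k}\sum_{p=1}^{N_k}\nabla_{x_i}\psi_i(x_{i,k},N\hat v_{i,k};\xi_k^p)-\nabla_{x_i}f_i(x_{i,k},N\hat v_{i,k}),$$ where the $\xi_k^p$ have the law of $\xi$ and $\mathrm{prox}_{\alpha r}(u)=\operatorname{argmin}_z\big(r(z)+\frac1{2\alpha}\|z-u\|^2\big)$. The estimates are updated by $v_{i,k+1}=\hat v_{i,k}+x_{i,k+1}-x_{i,k}$ for all $i,k$; the result also holds if instead $v_{i,k+1}=v_{i,k}+x_{i,k+1}-x_{i,k}$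 for all $i,k$. With $\mathcal F_k=\sigma(x_0,\dots,x_k)$, the errors are square integrable and, for constants $\nu_i$, $\mathbb E[e_{i,k}\mid\mathcal F_k]=0$ and $\mathbb E[\|e_{i,k}\|^2\mid\mathcal F_k]\le\nu_i^2/N_k$ a.s. **Theorem.** Let $x^*$ be a Nash equilibrium, $\alpha\in(0,\eta/L^2)$ and $\varrho=1-2\alpha\eta+2\alpha^2L^2$. Constants $\theta,\beta$ as above exist whenever some $a_{ii}>0$ or $\mathcal G$ is not bipartite. For every such pair $(\theta,\beta)$, all iterates as above and every $C>0$ with $\mathbb E\|x_0-x^*\|^2\le C$, the variables $\|x_k-x^*\|^2$ are integrable and for all $k\ge0$: (i) if $\beta\ne\varrho^2$, then $\mathbb E\|x_k-x^*\|^2\le\Big(C+\dfrac{C_3}{1-\min\{\varrho/\sqrt\beta,\sqrt\beta/\varrho\}}\Big)\max\{\varrho,\sqrt\beta\}^k$, with the convention $\sqrt\beta/\varrho=0$ if $\varrho=0$; (ii) if $\beta=\varrho^2$ and $\varrho>0$, then for every $\tilde\varrho\in(\varrho,1)$, $\mathbb E\|x_k-x^*\|^2\le\Big(C+\dfrac{C_3}{\ln((\tilde\varrho/\varrho)^e)}\Big)\tilde\varrho^{\,k}$.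 Here $M=\sum_j\max_{z\in\mathcal R_j}\|z\|$, $C_1=M\theta\big(1+2e\sqrt{1/\ln(\beta^{-1/2})}\big)$, $C_2=\dfrac{4M\theta}{\ln(1/\beta)}$, and $$C_3=\alpha^2\sum_i\nu_i^2+4\alpha MN\big(C_1\beta^{1/2}+C_2\big)\sum_iL_i+4\alpha^2N^2\big(C_1^2\beta^{3/2}+C_2^2\beta^{1/2}\big)\sum_iL_i^2 .$$ (The number $\varrho$ is automatically positive unless every $\mathcal R_i$ is a single point.) -/

import Mathlib

open MeasureTheory ProbabilityTheory Topology

noncomputable section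

/-- Decision vectors: `ℝ^m` with the Euclidean norm. -/
abbrev Vec (m : ℕ) : Type := EuclideanSpace ℝ (Fin m)

/-- Squared Euclidean norm of a strategy profile `x = (x_1, …, x_N) ∈ ℝ^{Nm}`. -/
def sqNorm {N m : ℕ} (x : Fin N → Vec m) : ℝ := ∑ i, ‖x i‖ ^ 2

/-- Euclidean inner product of two strategy profiles. -/
def profInner {N m : ℕ} (x y : Fin N → Vec m) : ℝ := ∑ i, inner ℝ (x i) (y i)

/-- The gradient in a player's own decision of a cost `h (x_i, y)`, where `y` is (an estimate of)
the aggregate of all decisions. The player's decision also enters the aggregate, so what stays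
fixed is the contribution `y - x` of the other players: this is the gradient at `z = x` of
`z ↦ h (z, z + (y - x))`. -/
def ownGrad {m : ℕ} (h : Vec m → Vec m → ℝ) (x y : Vec m) : Vec m :=
  gradient (fun z => h z (z + (y - x))) x

/-- `p` is a minimizer of `z ↦ r z + ‖z - u‖² / (2 α)`, that is, `p = prox_{α r}(u)`. -/
def IsProx {m : ℕ} (α : ℝ) (r : Vec m → EReal) (u p : Vec m) : Prop :=
  ∀ z : Vec m, r p + ((‖p - u‖ ^ 2 / (2 * α) : ℝ) : EReal)
    ≤ r z + ((‖z - u‖ ^ 2 / (2 * α) : ℝ) : EReal)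

/-- The data of a stochastic aggregative game with `N` players deciding in `ℝ^m`:
the sampled costs `psi i x_i y s` (own decision, aggregate, sample in `ℝ^d`) and
the extended-valued nonsmooth terms `r i`. -/
structure AggGame (N m d : ℕ) where
  psi : Fin N → Vec m → Vec m → Vec d → ℝ
  r : Fin N → Vec m → EReal

namespace AggGame

variable {N m d : ℕ} {Ω : Type*} [MeasurableSpace Ω]

/-- The effective domain `R_i` of `r_i`. -/
def dom (g : AggGame N m d) (i : Fin N) : Set (Vec m) := {z | g.r i z < ⊤}

/-- The set `R = ∏ R_i` of strategy profiles. -/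
def profiles (g : AggGame N m d) : Set (Fin N → Vec m) := {x | ∀ i, x i ∈ g.dom i}

/-- The set `R_1 + … + R_N` of aggregates. -/
def aggregates (g : AggGame N m d) : Set (Vec m) := {y | ∃ x ∈ g.profiles, y = ∑ i, x i}

/-- The expected cost `f_i(x_i, y) = E[ψ_i(x_i, y; ξ)]`. -/
def cost (g : AggGame N m d) (P : Measure Ω) (ξ : Ω → Vec d) (i : Fin N) (x y : Vec m) : ℝ :=
  ∫ ω, g.psi i x y (ξ ω) ∂P

/-- `∇_{x_i} f_i(x_i, y)`. -/
def grad (g : AggGame N m d) (P : Measure Ω) (ξ : Ω → Vec d) (i : Fin N) (x y : Vec m) : Vec m :=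
  ownGrad (g.cost P ξ i) x y

/-- `∇_{x_i} ψ_i(x_i, y; s)`. -/
def sampleGrad (g : AggGame N m d) (i : Fin N) (x y : Vec m) (s : Vec d) : Vec m :=
  ownGrad (fun x' y' => g.psi i x' y' s) x y

/-- The gradient map `φ(x) = (∇_{x_i} f_i(x_i, x_1 + … + x_N))_i`. -/
def pseudoGrad (g : AggGame N m d) (P : Measure Ω) (ξ : Ω → Vec d) (x : Fin N → Vec m) :
    Fin N → Vec m :=
  fun i => g.grad P ξ i (x i) (∑ j, x j)

/-- The aggregate of the decisions of all players but `i`. -/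
def others (i : Fin N) (x : Fin N → Vec m) : Vec m := ∑ j ∈ Finset.univ.erase i, x j

/-- Nash equilibrium: no player can lower `f_i(x_i, x_i + ∑_{j ≠ i} x_j) + r_i(x_i)` by changing
the own decision `x_i`. -/
def IsNash (g : AggGame N m d) (P : Measure Ω) (ξ : Ω → Vec d) (x : Fin N → Vec m) : Prop :=
  x ∈ g.profiles ∧ ∀ i, ∀ z : Vec m,
    ((g.cost P ξ i (x i) (x i + others i x) : ℝ) : EReal) + g.r i (x i)
      ≤ ((g.cost P ξ i z (z + others i x) : ℝ) : EReal) + g.r i z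

/-- The constant `M = ∑_j max_{z ∈ R_j} ‖z‖`. -/
def radius (g : AggGame N m d) : ℝ := ∑ j, sSup ((fun z : Vec m => ‖z‖) '' g.dom j)

/-- Standing conditions on the players' problems. `Y` is a set of values of the (estimated)
aggregate at which gradients are evaluated. -/
structure Regular (g : AggGame N m d) (P : Measure Ω) (ξ : Ω → Vec d) (Y : Set (Vec m)) :
    Prop where
  r_ne_bot : ∀ i z, g.r i z ≠ ⊥
  r_lsc : ∀ i, LowerSemicontinuous (g.r i)
  r_convex : ∀ i, Convex ℝ {p : Vec m × ℝ | g.r i p.1 ≤ (p.2 : EReal)}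
  dom_compact : ∀ i, IsCompact (g.dom i)
  /-- For fixed decisions of the others, the expected cost of player `i` is well defined, `C¹` and
  convex in the own decision on an open set containing `R_i`. -/
  cost_smooth : ∀ i, ∀ x ∈ g.profiles, ∃ O : Set (Vec m), IsOpen O ∧ g.dom i ⊆ O ∧
    (∀ z ∈ O, Integrable (fun ω => g.psi i z (z + others i x) (ξ ω)) P) ∧
    ContDiffOn ℝ 1 (fun z => g.cost P ξ i z (z + others i x)) O ∧
    ConvexOn ℝ O (fun z => g.cost P ξ i z (z + others i x))
  /-- At the points of `R_i × Y` the expected and the sampled costs can be differentiated in the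
  own decision, and the expectation of the sampled gradient is the gradient. -/
  cost_defined : ∀ i, ∀ x ∈ g.dom i, ∀ y ∈ Y,
    ∀ᶠ z in 𝓝 x, Integrable (fun ω => g.psi i z (z + (y - x)) (ξ ω)) P
  cost_diff : ∀ i, ∀ x ∈ g.dom i, ∀ y ∈ Y,
    DifferentiableAt ℝ (fun z => g.cost P ξ i z (z + (y - x))) x
  psi_diff : ∀ i, ∀ x ∈ g.dom i, ∀ y ∈ Y, ∀ s : Vec d,
    DifferentiableAt ℝ (fun z => g.psi i z (z + (y - x)) s) x
  sampleGrad_integrable : ∀ i, ∀ x ∈ g.dom i, ∀ y ∈ Y,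
    Integrable (fun ω => g.sampleGrad i x y (ξ ω)) P
  grad_eq : ∀ i, ∀ x ∈ g.dom i, ∀ y ∈ Y,
    g.grad P ξ i x y = ∫ ω, g.sampleGrad i x y (ξ ω) ∂P
  grad_measurable : ∀ i,
    Measurable (fun p : (g.dom i ×ˢ Y : Set (Vec m × Vec m)) => g.grad P ξ i p.1.1 p.1.2)

/-- `φ` is `η`-strongly monotone and `L`-Lipschitz on `R`, and `∇_{x_i} f_i(x_i, ·)` is
`Lᵢ i`-Lipschitz on `Y`. -/
structure GradientBounds (g : AggGame N m d) (P : Measure Ω) (ξ : Ω → Vec d) (Y : Set (Vec m))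
    (η L : ℝ) (Lᵢ : Fin N → ℝ) : Prop where
  L_pos : 0 < L
  Li_nonneg : ∀ i, 0 ≤ Lᵢ i
  strongly_monotone : ∀ x ∈ g.profiles, ∀ y ∈ g.profiles,
    η * sqNorm (x - y) ≤ profInner (g.pseudoGrad P ξ x - g.pseudoGrad P ξ y) (x - y)
  lipschitz : ∀ x ∈ g.profiles, ∀ y ∈ g.profiles,
    Real.sqrt (sqNorm (g.pseudoGrad P ξ x - g.pseudoGrad P ξ y)) ≤ L * Real.sqrt (sqNorm (x - y))
  lipschitz_agg : ∀ i, ∀ x ∈ g.dom i, ∀ y₁ ∈ Y, ∀ y₂ ∈ Y,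
    ‖g.grad P ξ i x y₁ - g.grad P ξ i x y₂‖ ≤ Lᵢ i * ‖y₁ - y₂‖

end AggGame

/-- `A` is a symmetric weight matrix with unit row sums on the undirected graph `G`: positive on
edges, zero between distinct non-neighbours. A player may give weight to the own value. -/
structure IsWeightMatrix {N : ℕ} (G : SimpleGraph (Fin N)) (A : Matrix (Fin N) (Fin N) ℝ) :
    Prop where
  symm : A.IsSymm
  row_sum : ∀ i, ∑ j, A i j = 1
  pos_of_adj : ∀ i j, G.Adj i j → 0 < A i j
  zero_of_not_adj : ∀ i j, i ≠ j → ¬ G.Adj i j → A i j = 0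
  diag_nonneg : ∀ i, 0 ≤ A i i

/-- The powers of `A` approach the averaging matrix geometrically, with constants `θ`, `β`. -/
structure IsMixingPair {N : ℕ} (A : Matrix (Fin N) (Fin N) ℝ) (θ β : ℝ) : Prop where
  theta_pos : 0 < θ
  beta_pos : 0 < β
  beta_lt_one : β < 1
  bound : ∀ (k : ℕ) (i j : Fin N), |(A ^ k) i j - 1 / (N : ℝ)| ≤ θ * β ^ k

/-- One round of communication: every player averages the values of the neighbours
(`A i j = 0` for the others). -/
def consensusRound {N m : ℕ} (A : Matrix (Fin N) (Fin N) ℝ) (v : Fin N → Vec m) : Fin N → Vec m :=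
  fun i => ∑ j, A i j • v j

/-- The estimates after the `τ_k = k + 1` rounds of communication in iteration `k`. -/
def consensus {N m : ℕ} (A : Matrix (Fin N) (Fin N) ℝ) (k : ℕ) (v : Fin N → Vec m) :
    Fin N → Vec m :=
  (consensusRound A)^[k + 1] v

/-- The batch size `N_k = ⌈β^{-(k+1)/2}⌉`. -/
def batchSize (β : ℝ) (k : ℕ) : ℕ := ⌈β ^ (-(((k : ℝ) + 1) / 2))⌉₊

/-- The sampling error `e_{i,k}` of the batch of `n` sampled gradients. -/
def gradError {N m d : ℕ} {Ω : Type*} [MeasurableSpace Ω] (g : AggGame N m d) (P : Measure Ω)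
    (ξ : Ω → Vec d) (n : ℕ) (samples : ℕ → Vec d) (i : Fin N) (x y : Vec m) : Vec m :=
  (n : ℝ)⁻¹ • (∑ p ∈ Finset.range n, g.sampleGrad i x y (samples p)) - g.grad P ξ i x y

/-- The random vector `e_{i,k}` along the iterates `x`, `v` with samples `ξs k p`. -/
def errorProc {N m d : ℕ} {Ω : Type*} [MeasurableSpace Ω] (g : AggGame N m d) (P : Measure Ω)
    (ξ : Ω → Vec d) (ξs : ℕ → ℕ → Ω → Vec d) (A : Matrix (Fin N) (Fin N) ℝ) (β : ℝ)
    (x v : ℕ → Ω → Fin N → Vec m) (i : Fin N) (k : ℕ) (ω : Ω) : Vec m :=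
  gradError g P ξ (batchSize β k) (fun p => ξs k p ω) i (x k ω i)
    ((N : ℝ) • consensus A k (v k ω) i)

/-- `x` (strategies) and `v` (estimates of the average decision) are generated by the distributed
variable sample-size proximal gradient response scheme with step size `α`, `τ_k = k + 1` rounds of
communication and batch sizes `⌈β^{-(k+1)/2}⌉`. -/
structure IsDistributedVSPGR {N m d : ℕ} {Ω : Type*} [MeasurableSpace Ω] (g : AggGame N m d)
    (P : Measure Ω) (ξ : Ω → Vec d) (ξs : ℕ → ℕ → Ω → Vec d) (A : Matrix (Fin N) (Fin N) ℝ)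
    (α β : ℝ) (x v : ℕ → Ω → Fin N → Vec m) : Prop where
  sample_law : ∀ k, ∀ p < batchSize β k, IdentDistrib (ξs k p) ξ P P
  measurable_x : ∀ k, Measurable (x k)
  x_zero_mem : ∀ ω, x 0 ω ∈ g.profiles
  v_zero : ∀ ω, v 0 ω = x 0 ω
  x_succ : ∀ k ω i, IsProx α (g.r i)
    (x k ω i - α • (g.grad P ξ i (x k ω i) ((N : ℝ) • consensus A k (v k ω) i)
      + errorProc g P ξ ξs A β x v i k ω)) (x (k + 1) ω i)
  /-- The estimate is corrected by the change of strategy, starting either from its value after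
  communication or from its value before communication. -/
  v_succ :
    (∀ k ω i, v (k + 1) ω i = consensus A k (v k ω) i + x (k + 1) ω i - x k ω i) ∨
    (∀ k ω i, v (k + 1) ω i = v k ω i + x (k + 1) ω i - x k ω i)

/-- `F_k = σ(x_0, …, x_k)`. -/
abbrev history {N m : ℕ} {Ω : Type*} (x : ℕ → Ω → Fin N → Vec m) (k : ℕ) : MeasurableSpace Ω :=
  ⨆ l ≤ k, MeasurableSpace.comap (x l) inferInstance

/-- The sampling errors `e i k` are square integrable, conditionally unbiased, and have conditional
second moment at most `ν_i² / N_k`. -/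
structure NoiseCondition {N m : ℕ} {Ω : Type*} [MeasurableSpace Ω] (P : Measure Ω)
    (x : ℕ → Ω → Fin N → Vec m) (e : Fin N → ℕ → Ω → Vec m) (β : ℝ) (ν : Fin N → ℝ) : Prop where
  memLp : ∀ i k, MemLp (e i k) 2 P
  unbiased : ∀ i k, P[e i k | history x k] =ᵐ[P] 0
  variance : ∀ i k, P[fun ω => ‖e i k ω‖ ^ 2 | history x k] ≤ᵐ[P]
    fun _ => ν i ^ 2 / (batchSize β k : ℝ)

/-- `E ‖x_k - x*‖²`. -/
def meanSqError {N m : ℕ} {Ω : Type*} [MeasurableSpace Ω] (P : Measure Ω)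
    (x : ℕ → Ω → Fin N → Vec m) (xstar : Fin N → Vec m) (k : ℕ) : ℝ :=
  ∫ ω, sqNorm (x k ω - xstar) ∂P

/-- `ϱ = 1 - 2 α η + 2 α² L²`. -/
def contraction (α η L : ℝ) : ℝ := 1 - 2 * α * η + 2 * α ^ 2 * L ^ 2

/-- `C₁ = M θ (1 + 2 e √(1 / ln(β^{-1/2})))`. -/
def constC1 (M θ β : ℝ) : ℝ :=
  M * θ * (1 + 2 * Real.exp 1 * Real.sqrt (1 / Real.log (β ^ (-(1 / 2 : ℝ)))))

/-- `C₂ = 4 M θ / ln(1/β)`. -/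
def constC2 (M θ β : ℝ) : ℝ := 4 * M * θ / Real.log (1 / β)

/-- The constant `C₃`. -/
def constC3 {N : ℕ} (M θ β α : ℝ) (ν Lᵢ : Fin N → ℝ) : ℝ :=
  α ^ 2 * ∑ i, ν i ^ 2
    + 4 * α * M * N * (constC1 M θ β * β ^ (1 / 2 : ℝ) + constC2 M θ β) * ∑ i, Lᵢ i
    + 4 * α ^ 2 * (N : ℝ) ^ 2
      * (constC1 M θ β ^ 2 * β ^ (3 / 2 : ℝ) + constC2 M θ β ^ 2 * β ^ (1 / 2 : ℝ)) * ∑ i, Lᵢ i ^ 2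

end

/-!
Write `q = √β` and `ϱ = contraction α η L`. The scheme is a proximal gradient iteration for the
variational inequality of the game, perturbed by two errors per step, and the theorem is the
resulting recursion `E (k + 1) ≤ ϱ E k + C₃ q ^ (k + 1)` for the mean square error, solved.

* An equilibrium is a fixed point of the exact proximal gradient step, since both sides are
  first-order conditions for minimizing a differentiable function plus a convex one
  (`toReal_le_add_inner_of_minimizer`). As the proximal map is nonexpansive
  (`IsProx.norm_sub_le`), the new error is at most the distance of the forward steps, which
  strong monotonicity and the Lipschitz bound contract by `ϱ` up to the error in the gradients
  (`sum_norm_sub_smul_sq_le`).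
* The error of the aggregate estimates is `O(q ^ (k + 1))` (`norm_smul_consensus_sub_sum_le`).
  When estimates are corrected after communication, the deviation from the mean is carried
  through the induction for an arbitrary number of additional averaging rounds, because the bound
  on the entries of `A ^ k` cannot be multiplied over successive iterations (the constants `θ`
  would accumulate) whereas powers of `A` can be merged first. When they are corrected before
  communication, the estimates are the strategies themselves.
* The sampling errors are orthogonal in `L²` to everything determined by the history
  (`integral_norm_sub_smul_sq`), so they only add their second moments, which the batch sizes make
  `O(q ^ (k + 1))`. These facts give the recursion (`IsDistributedVSPGR.meanSqError_succ_le`,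
  `perturbation_le_constC3`).
* The recursion is solved in `le_mul_max_pow_of_recursion` for `q ≠ ϱ` and in
  `le_mul_pow_of_recursion_of_eq` for `q = ϱ`. These need `0 ≤ ϱ`; a negative `ϱ` forces a single
  strategy profile, for which there is nothing to estimate (`AggGame.contraction_pos_of_ne`).

The existence of a mixing pair is Doeblin's argument: an aperiodic connected weight matrix has a
power with entries at least some `δ > 0`, and that power contracts matrices with zero column sums
by `1 - N δ` (`IsWeightMatrix.exists_isMixingPair`).
-/

/-! ### Weight matrices: powers and geometric mixing -/

section Mixing

variable {N : ℕ} {G : SimpleGraph (Fin N)} {A : Matrix (Fin N) (Fin N) ℝ}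

lemma IsWeightMatrix.nonneg (hA : IsWeightMatrix G A) (i j : Fin N) : 0 ≤ A i j := by
  rcases eq_or_ne i j with rfl | hij
  · exact hA.diag_nonneg i
  · by_cases h : G.Adj i j
    · exact (hA.pos_of_adj i j h).le
    · exact (hA.zero_of_not_adj i j hij h).ge

lemma IsWeightMatrix.mem_doublyStochastic (hA : IsWeightMatrix G A) :
    A ∈ doublyStochastic ℝ (Fin N) := by
  rw [mem_doublyStochastic_iff_sum]
  refine ⟨hA.nonneg, hA.row_sum, fun j => ?_⟩
  simp_rw [fun i => hA.symm.apply j i]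
  exact hA.row_sum j

lemma IsWeightMatrix.pow_mem_doublyStochastic (hA : IsWeightMatrix G A) (k : ℕ) :
    A ^ k ∈ doublyStochastic ℝ (Fin N) :=
  pow_mem hA.mem_doublyStochastic k

lemma IsWeightMatrix.pow_pos_trans (hA : IsWeightMatrix G A) {a b : ℕ} {i j l : Fin N}
    (h₁ : 0 < (A ^ a) i j) (h₂ : 0 < (A ^ b) j l) : 0 < (A ^ (a + b)) i l := by
  rw [pow_add, Matrix.mul_apply]
  refine Finset.sum_pos' (fun s _ => mul_nonneg ?_ ?_) ⟨j, Finset.mem_univ _, mul_pos h₁ h₂⟩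
  · exact nonneg_of_mem_doublyStochastic (hA.pow_mem_doublyStochastic a)
  · exact nonneg_of_mem_doublyStochastic (hA.pow_mem_doublyStochastic b)

lemma IsWeightMatrix.pow_length_pos (hA : IsWeightMatrix G A) {i j : Fin N} (p : G.Walk i j) :
    0 < (A ^ p.length) i j := by
  induction p with
  | nil => simp
  | cons h p ih =>
    rw [SimpleGraph.Walk.length_cons, add_comm]
    exact hA.pow_pos_trans (by simpa using hA.pos_of_adj _ _ h) ih

/-- Moving along some edge or loop and back shows that returning in any even number of steps is
possible. -/
lemma IsWeightMatrix.pow_even_diag_pos (hA : IsWeightMatrix G A) (i : Fin N) (s : ℕ) :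
    0 < (A ^ (2 * s)) i i := by
  induction s with
  | zero => simp
  | succ s ih =>
    obtain ⟨j, hj⟩ : ∃ j, 0 < A i j := by
      by_contra! h
      have := Finset.sum_nonpos fun j (_ : j ∈ Finset.univ) => h j
      rw [hA.row_sum] at this
      linarith
    have h2 : 0 < (A ^ (1 + 1)) i i :=
      hA.pow_pos_trans (by simpa using hj) (by simpa [hA.symm.apply i j] using hj)
    exact hA.pow_pos_trans ih h2

/-- A connected weight matrix that is not periodic (it has a loop of positive weight, or its graph
has an odd cycle) has a power with positive entries: through a vertex `w` lying on an odd closed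
walk, any two vertices are joined by walks of both parities, hence of every large length. -/
lemma IsWeightMatrix.exists_pow_pos (hA : IsWeightMatrix G A) (hG : G.Connected)
    (h : (∃ i, 0 < A i i) ∨ ¬ G.Colorable 2) : ∃ K, 0 < K ∧ ∀ i j, 0 < (A ^ K) i j := by
  obtain ⟨w, l, hl, hw⟩ : ∃ (w : Fin N) (l : ℕ), Odd l ∧ 0 < (A ^ l) w w := by
    rcases h with ⟨i, hi⟩ | h
    · exact ⟨i, 1, odd_one, by simpa using hi⟩
    · rw [SimpleGraph.two_colorable_iff_forall_loop_even] at h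
      push Not at h
      obtain ⟨u, p, hp⟩ := h
      exact ⟨u, p.length, by simpa using hp, hA.pow_length_pos p⟩
  let p : ∀ i, G.Walk i w := fun i => (hG.preconnected i w).some
  have ha : ∀ i, (p i).length ≤ ∑ j, (p j).length := fun i =>
    Finset.single_le_sum (f := fun j => (p j).length) (fun _ _ => Nat.zero_le _)
      (Finset.mem_univ i)
  refine ⟨2 * ∑ j, (p j).length + l, by have := hl.pos; omega, fun i j => ?_⟩
  have h₁ := hA.pow_length_pos (p i)
  have h₂ := hA.pow_length_pos (p j).reverse
  rw [SimpleGraph.Walk.length_reverse] at h₂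
  obtain ⟨c, hc⟩ : ∃ c, 2 * ∑ j, (p j).length = (p i).length + (p j).length + c :=
    Nat.exists_eq_add_of_le (by have := ha i; have := ha j; omega)
  rcases Nat.even_or_odd' c with ⟨s, rfl | rfl⟩
  · have := hA.pow_pos_trans (hA.pow_pos_trans (hA.pow_pos_trans h₁ hw) h₂)
      (hA.pow_even_diag_pos j s)
    rwa [show (p i).length + l + (p j).length + 2 * s = 2 * ∑ j, (p j).length + l by
      omega] at this
  · obtain ⟨t, rfl⟩ := hl
    have := hA.pow_pos_trans (hA.pow_pos_trans h₁ h₂) (hA.pow_even_diag_pos j (s + t + 1))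
    rwa [show (p i).length + (p j).length + 2 * (s + t + 1)
      = 2 * ∑ j, (p j).length + (2 * t + 1) by omega] at this

/-- Doeblin contraction: a matrix with unit row sums and entries at least `δ` shrinks the entries
of a matrix with zero column sums, because `δ` may be subtracted from all its entries. -/
lemma Matrix.abs_mul_apply_le_of_le_entries {B X : Matrix (Fin N) (Fin N) ℝ} {δ c : ℝ}
    (hrow : ∀ i, ∑ j, B i j = 1) (hB : ∀ i j, δ ≤ B i j) (hX : ∀ j, ∑ i, X i j = 0)
    (hc : ∀ i j, |X i j| ≤ c) (i j : Fin N) : |(B * X) i j| ≤ (1 - N * δ) * c := by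
  have h : (B * X) i j = ∑ l, (B i l - δ) * X l j := by
    simp [Matrix.mul_apply, sub_mul, Finset.sum_sub_distrib, ← Finset.mul_sum, hX]
  rw [h]
  calc |∑ l, (B i l - δ) * X l j| ≤ ∑ l, |(B i l - δ) * X l j| := Finset.abs_sum_le_sum_abs _ _
    _ ≤ ∑ l, (B i l - δ) * c := by
        refine Finset.sum_le_sum fun l _ => ?_
        rw [abs_mul, abs_of_nonneg (sub_nonneg.2 (hB i l))]
        exact mul_le_mul_of_nonneg_left (hc l j) (sub_nonneg.2 (hB i l))
    _ = (1 - N * δ) * c := by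
        rw [← Finset.sum_mul, Finset.sum_sub_distrib, hrow]
        simp

theorem IsWeightMatrix.exists_isMixingPair (hA : IsWeightMatrix G A) (hG : G.Connected)
    (h : (∃ i, 0 < A i i) ∨ ¬ G.Colorable 2) : ∃ θ β : ℝ, IsMixingPair A θ β := by
  obtain ⟨K, hK, hpos⟩ := hA.exists_pow_pos hG h
  have : Nonempty (Fin N) := hG.nonempty
  have hN : 0 < N := Fin.pos_iff_nonempty.2 this
  have hN1 : (1 : ℝ) ≤ N := by exact_mod_cast hN
  obtain ⟨⟨i₀, j₀⟩, hmin⟩ := Finite.exists_min fun s : Fin N × Fin N => (A ^ K) s.1 s.2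
  set δ := (A ^ K) i₀ j₀ with hδ
  have hδ0 : 0 < δ := hpos _ _
  set γ : ℝ := max (1 - N * δ) (1 / 2) with hγ
  have hγ0 : 0 < γ := lt_max_of_lt_right (by norm_num)
  have hγ1 : γ < 1 := max_lt (by have := mul_pos (zero_lt_one.trans_le hN1) hδ0; linarith)
    (by norm_num)
  have key : ∀ n r i j, |(A ^ (K * n + r)) i j - 1 / (N : ℝ)| ≤ γ ^ n := by
    intro n r
    induction n with
    | zero =>
      intro i j
      have h0 : 0 ≤ (A ^ r) i j := nonneg_of_mem_doublyStochastic (hA.pow_mem_doublyStochastic r)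
      have h1 : (A ^ r) i j ≤ 1 := le_one_of_mem_doublyStochastic (hA.pow_mem_doublyStochastic r)
      have h2 : 0 < 1 / (N : ℝ) := by positivity
      have h3 : 1 / (N : ℝ) ≤ 1 := by rw [div_le_one (by linarith)]; exact hN1
      simp only [mul_zero, zero_add, pow_zero]
      rw [abs_le]
      constructor <;> linarith
    | succ n ih =>
      intro i j
      have hrow := sum_row_of_mem_doublyStochastic (hA.pow_mem_doublyStochastic K)
      have hX : ∀ j, ∑ i, (A ^ (K * n + r) -
          (Matrix.of fun _ _ => 1 / (N : ℝ) : Matrix (Fin N) (Fin N) ℝ)) i j = 0 := by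
        intro j
        simp only [Matrix.sub_apply, Matrix.of_apply, Finset.sum_sub_distrib,
          sum_col_of_mem_doublyStochastic (hA.pow_mem_doublyStochastic _)]
        simp
        field_simp
        simp
      have hcon := Matrix.abs_mul_apply_le_of_le_entries hrow (fun i j => hmin (i, j)) hX
        (c := γ ^ n) (fun i j => by simpa using ih i j) i j
      have heq : (A ^ K * (A ^ (K * n + r) -
          (Matrix.of fun _ _ => 1 / (N : ℝ) : Matrix (Fin N) (Fin N) ℝ))) i j
          = (A ^ (K * (n + 1) + r)) i j - 1 / (N : ℝ) := by
        rw [mul_sub, ← pow_add, Matrix.sub_apply, show K + (K * n + r) = K * (n + 1) + r by ring]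
        congr 1
        rw [Matrix.mul_apply]
        simp only [Matrix.of_apply]
        rw [← Finset.sum_mul, hrow, one_mul]
      rw [heq] at hcon
      rw [pow_succ']
      exact hcon.trans (mul_le_mul_of_nonneg_right (le_max_left _ _) (by positivity))
  have hβ : (γ ^ (1 / (K : ℝ))) ^ K = γ := by
    rw [one_div]
    exact Real.rpow_inv_natCast_pow hγ0.le hK.ne'
  have hβ0 : 0 < γ ^ (1 / (K : ℝ)) := Real.rpow_pos_of_pos hγ0 _
  have hβ1 : γ ^ (1 / (K : ℝ)) < 1 :=
    Real.rpow_lt_one hγ0.le hγ1 (one_div_pos.2 (by exact_mod_cast hK))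
  refine ⟨1 / γ, γ ^ (1 / (K : ℝ)), by positivity, hβ0, hβ1, fun k i j => ?_⟩
  set β := γ ^ (1 / (K : ℝ))
  have hk := key (k / K) (k % K) i j
  rw [Nat.div_add_mod] at hk
  refine hk.trans ?_
  -- the last, incomplete block of fewer than `K` factors is absorbed by `θ = 1 / γ = β ^ (-K)`
  rw [one_div, ← div_eq_inv_mul, le_div_iff₀ hγ0, ← hβ, ← pow_mul, ← pow_add]
  refine pow_le_pow_of_le_one hβ0.le hβ1.le ?_
  have := Nat.div_add_mod k K
  have := Nat.mod_lt k hK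
  omega

end Mixing

/-! ### Variational inequalities for equilibria and proximal points -/

section Variational

variable {m : ℕ}

/-- First-order condition for a minimizer `p` of `h + r`, with `h` differentiable at `p` and `r`
convex; `h` need not be convex. -/
lemma toReal_le_add_inner_of_minimizer {r : Vec m → EReal} (hbot : ∀ z, r z ≠ ⊥)
    (hconv : Convex ℝ {p : Vec m × ℝ | r p.1 ≤ (p.2 : EReal)}) {h : Vec m → ℝ} {v p z : Vec m}
    (hh : HasGradientAt h v p) (hmin : ∀ z, (h p : EReal) + r p ≤ h z + r z)
    (hp : r p < ⊤) (hz : r z < ⊤) : (r p).toReal ≤ (r z).toReal + inner ℝ v (z - p) := by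
  have hp' := EReal.coe_toReal hp.ne (hbot p)
  have hz' := EReal.coe_toReal hz.ne (hbot z)
  set a := (r p).toReal
  set b := (r z).toReal
  have hder : HasDerivAt (fun t : ℝ => h (p + t • (z - p))) (inner ℝ v (z - p)) 0 := by
    have h1 : HasDerivAt (fun t : ℝ => p + t • (z - p)) (z - p) 0 := by
      simpa using ((hasDerivAt_id (0 : ℝ)).smul_const (z - p)).const_add p
    have h2 : HasFDerivAt h (InnerProductSpace.toDual ℝ (Vec m) v) (p + (0 : ℝ) • (z - p)) := by
      simpa using hh.hasFDerivAt
    simpa [Function.comp_def] using h2.comp_hasDerivAt (0 : ℝ) h1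
  have hlim := hder.tendsto_slope_zero_right
  have hle : ∀ᶠ t in 𝓝[>] (0 : ℝ),
      a - b ≤ t⁻¹ • (h (p + (0 + t) • (z - p)) - h (p + (0 : ℝ) • (z - p))) := by
    filter_upwards [Ioo_mem_nhdsGT (zero_lt_one' ℝ)] with t ht
    have hc := hconv (x := (p, a)) (by simp [hp']) (y := (z, b)) (by simp [hz'])
      (sub_nonneg.2 ht.2.le) ht.1.le (by ring)
    have hpt : (1 - t) • p + t • z = p + t • (z - p) := by
      rw [sub_smul, smul_sub, one_smul]; abel
    simp only [Prod.smul_mk, Prod.mk_add_mk, Set.mem_ofPred_eq, hpt, smul_eq_mul] at hc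
    have h3 := (hmin (p + t • (z - p))).trans (add_le_add_right hc _)
    rw [← hp', ← EReal.coe_add, ← EReal.coe_add, EReal.coe_le_coe_iff] at h3
    rw [zero_add, zero_smul, add_zero, smul_eq_mul, ← div_eq_inv_mul, le_div_iff₀ ht.1]
    linarith
  have := ge_of_tendsto hlim hle
  linarith

lemma hasGradientAt_norm_sub_sq_div (α : ℝ) (u p : Vec m) :
    HasGradientAt (fun z : Vec m => ‖z - u‖ ^ 2 / (2 * α)) (α⁻¹ • (p - u)) p := by
  rw [hasGradientAt_iff_hasFDerivAt]
  have h := (((hasFDerivAt_id (𝕜 := ℝ) p).sub_const u).norm_sq).mul_const (2 * α)⁻¹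
  simp only [← div_eq_mul_inv] at h
  refine h.congr_fderiv ?_
  ext w
  simp
  ring

lemma IsProx.dom {α : ℝ} {r : Vec m → EReal} {u p z : Vec m} (h : IsProx α r u p)
    (hz : r z < ⊤) : r p < ⊤ := by
  have h1 := h z
  by_contra! h2
  rw [top_le_iff.1 h2, EReal.top_add_coe, top_le_iff] at h1
  exact (EReal.add_lt_top hz.ne (EReal.coe_ne_top _)).ne h1

/-- If `y` solves the variational inequality of `r` with gradient `v`, then `y` is the proximal
point of `y - α v`, and the proximal map is nonexpansive. -/
lemma IsProx.norm_sub_le {r : Vec m → EReal} (hbot : ∀ z, r z ≠ ⊥)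
    (hconv : Convex ℝ {p : Vec m × ℝ | r p.1 ≤ (p.2 : EReal)}) {α : ℝ} (hα : 0 < α)
    {u p y v : Vec m} (hprox : IsProx α r u p) (hy : r y < ⊤)
    (hvar : ∀ z, r z < ⊤ → (r y).toReal ≤ (r z).toReal + inner ℝ v (z - y)) :
    ‖p - y‖ ≤ ‖u - (y - α • v)‖ := by
  have hp := hprox.dom hy
  have h1 := toReal_le_add_inner_of_minimizer hbot hconv (hasGradientAt_norm_sub_sq_div α u p)
    (fun z => by rw [add_comm, add_comm _ (r z)]; exact hprox z) hp hy
  have h2 := hvar p hp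
  have h3 : inner ℝ (α⁻¹ • (p - u)) (y - p) = -(α⁻¹ * inner ℝ (p - u) (p - y)) := by
    rw [inner_smul_left, ← neg_sub p y, inner_neg_right]; simp
  have h4 : inner ℝ (p - u) (p - y) ≤ α * inner ℝ v (p - y) := by
    have : α⁻¹ * inner ℝ (p - u) (p - y) ≤ inner ℝ v (p - y) := by linarith
    rwa [inv_mul_le_iff₀ hα] at this
  have h5 : ‖p - y‖ ^ 2 ≤ inner ℝ (u - (y - α • v)) (p - y) := by
    rw [← real_inner_self_eq_norm_sq]
    have : u - (y - α • v) = (p - y) - (p - u) + α • v := by abel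
    rw [this, inner_add_left, inner_sub_left (p - y) (p - u), inner_smul_left]
    simp only [conj_trivial]
    linarith
  by_contra! hlt
  have h6 := real_inner_le_norm (u - (y - α • v)) (p - y)
  have h7 : 0 < ‖p - y‖ := (norm_nonneg _).trans_lt hlt
  nlinarith

namespace AggGame

variable {N d : ℕ} {Ω : Type*} [MeasurableSpace Ω] {g : AggGame N m d} {P : Measure Ω}
  {ξ : Ω → Vec d} {Y : Set (Vec m)}

lemma sum_sub_eq_others (i : Fin N) (x : Fin N → Vec m) : ∑ j, x j - x i = others i x := by
  rw [others, Finset.sum_erase_eq_sub (Finset.mem_univ i)]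

lemma IsNash.toReal_le_add_inner (hreg : g.Regular P ξ Y) {x : Fin N → Vec m}
    (hx : g.IsNash P ξ x) (i : Fin N) (z : Vec m) (hz : g.r i z < ⊤) :
    (g.r i (x i)).toReal ≤ (g.r i z).toReal + inner ℝ (g.pseudoGrad P ξ x i) (z - x i) := by
  refine toReal_le_add_inner_of_minimizer (hreg.r_ne_bot i) (hreg.r_convex i)
    (h := fun z => g.cost P ξ i z (z + others i x)) ?_ (hx.2 i) (hx.1 i) hz
  obtain ⟨O, hO, hsub, -, hdiff, -⟩ := hreg.cost_smooth i x hx.1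
  have hat : DifferentiableAt ℝ (fun z => g.cost P ξ i z (z + others i x)) (x i) :=
    (hdiff.contDiffAt (hO.mem_nhds (hsub (hx.1 i)))).differentiableAt one_ne_zero
  have := hat.hasGradientAt
  rwa [pseudoGrad, grad, ownGrad, sum_sub_eq_others]

end AggGame

end Variational

/-! ### Consensus error of the aggregate estimates -/

section Consensus

variable {N m : ℕ} {G : SimpleGraph (Fin N)} {A : Matrix (Fin N) (Fin N) ℝ}

lemma consensusRound_iterate_apply (A : Matrix (Fin N) (Fin N) ℝ) (p : ℕ) (v : Fin N → Vec m)
    (i : Fin N) : (consensusRound A)^[p] v i = ∑ j, (A ^ p) i j • v j := by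
  induction p generalizing i with
  | zero => simp [Matrix.one_apply]
  | succ p ih =>
    rw [Function.iterate_succ_apply', consensusRound]
    simp_rw [ih, Finset.smul_sum, smul_smul]
    rw [Finset.sum_comm]
    simp_rw [← Finset.sum_smul, pow_succ', Matrix.mul_apply]

lemma consensus_apply (A : Matrix (Fin N) (Fin N) ℝ) (k : ℕ) (v : Fin N → Vec m) (i : Fin N) :
    consensus A k v i = ∑ j, (A ^ (k + 1)) i j • v j :=
  consensusRound_iterate_apply A (k + 1) v i

lemma sum_pow_smul_consensus (A : Matrix (Fin N) (Fin N) ℝ) (p k : ℕ) (v : Fin N → Vec m)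
    (i : Fin N) :
    ∑ j, (A ^ p) i j • consensus A k v j = ∑ j, (A ^ (p + (k + 1))) i j • v j := by
  rw [← consensusRound_iterate_apply, ← consensusRound_iterate_apply,
    Function.iterate_add_apply _ p (k + 1)]
  rfl

/-- `p` rounds of averaging bring all values close to their mean. -/
lemma IsMixingPair.norm_sub_mean_le {θ β : ℝ} (hm : IsMixingPair A θ β) (p : ℕ)
    (z : Fin N → Vec m) (i : Fin N) :
    ‖∑ j, (A ^ p) i j • z j - (N : ℝ)⁻¹ • ∑ j, z j‖ ≤ θ * β ^ p * ∑ j, ‖z j‖ := by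
  rw [Finset.smul_sum, ← Finset.sum_sub_distrib, Finset.mul_sum]
  refine (norm_sum_le _ _).trans (Finset.sum_le_sum fun j _ => ?_)
  rw [← sub_smul, norm_smul, Real.norm_eq_abs, ← one_div]
  exact mul_le_mul_of_nonneg_right (hm.bound p i j) (norm_nonneg _)

/-- The scalar inequality that closes the induction of `norm_sub_mean_le_of_tracking`. -/
lemma pow_mul_add_le_add_div_log {q : ℝ} (hq0 : 0 < q) (hq1 : q < 1) (k : ℕ) :
    q ^ (2 * k + 3) * (q + 2 / Real.log (1 / q)) + 2 * q ^ (k + 2)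
      ≤ q + 2 / Real.log (1 / q) := by
  have ha : 0 < Real.log (1 / q) := Real.log_pos (by rw [lt_div_iff₀ hq0]; linarith)
  have ha' : Real.log (1 / q) ≤ 1 / q - 1 := Real.log_le_sub_one_of_pos (by positivity)
  set a := Real.log (1 / q)
  have h1 : q ^ (2 * k + 3) ≤ q ^ 3 := pow_le_pow_of_le_one hq0.le hq1.le (by omega)
  have h2 : q ^ (k + 2) ≤ q ^ 2 := pow_le_pow_of_le_one hq0.le hq1.le (by omega)
  have h3 : a * q ^ 2 ≤ 1 - q ^ 3 := by
    have : a * q ^ 2 ≤ (1 / q - 1) * q ^ 2 := mul_le_mul_of_nonneg_right ha' (by positivity)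
    have e : (1 / q - 1) * q ^ 2 = q - q ^ 2 := by field_simp
    nlinarith [pow_pos hq0 2, pow_pos hq0 3]
  have h4 : q ^ 2 ≤ (1 - q ^ 3) / a := by rw [le_div_iff₀ ha]; linarith
  have h5 : (1 - q ^ 3) / a = 1 / a - q ^ 3 * (1 / a) := by ring
  have h6 : q ^ 4 ≤ q := by
    simpa using pow_le_pow_of_le_one hq0.le hq1.le (show 1 ≤ 4 by norm_num)
  have h7 : q ^ (2 * k + 3) * (q + 2 / a) ≤ q ^ 3 * (q + 2 / a) :=
    mul_le_mul_of_nonneg_right h1 (by positivity)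
  have h8 : q ^ 3 * (q + 2 / a) = q ^ 4 + 2 * (q ^ 3 * (1 / a)) := by ring
  have h9 : 2 / a = 2 * (1 / a) := by ring
  linarith

/-- Deviation from the mean strategy when the estimates are corrected after communication. The
bound holds for any number `p` of further averaging rounds; this generality lets the induction
merge the rounds of successive iterations. -/
lemma norm_sub_mean_le_of_tracking {θ q M : ℝ} (hq0 : 0 < q) (hq1 : q < 1)
    (hm : IsMixingPair A θ (q ^ 2)) {x v : ℕ → Fin N → Vec m} (hM : ∀ k, ∑ j, ‖x k j‖ ≤ M)
    (h0 : v 0 = x 0) (hv : ∀ k i, v (k + 1) i = consensus A k (v k) i + x (k + 1) i - x k i)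
    (k p : ℕ) (i : Fin N) :
    q ^ (k + 1) * ‖∑ j, (A ^ p) i j • v k j - (N : ℝ)⁻¹ • ∑ j, x k j‖
      ≤ M * θ * (q ^ 2) ^ p * (q + 2 / Real.log (1 / q)) := by
  have hM0 : 0 ≤ M := (Finset.sum_nonneg fun j _ => norm_nonneg _).trans (hM 0)
  have hθ := hm.theta_pos
  have ha : 0 < Real.log (1 / q) := Real.log_pos (by rw [lt_div_iff₀ hq0]; linarith)
  induction k generalizing p i with
  | zero =>
    have h1 := hm.norm_sub_mean_le p (x 0) i
    have h2 : θ * (q ^ 2) ^ p * ∑ j, ‖x 0 j‖ ≤ θ * (q ^ 2) ^ p * M :=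
      mul_le_mul_of_nonneg_left (hM 0) (by positivity)
    rw [h0]
    calc q ^ (0 + 1) * _ ≤ q ^ (0 + 1) * (θ * (q ^ 2) ^ p * M) :=
          mul_le_mul_of_nonneg_left (h1.trans h2) (by positivity)
      _ = M * θ * (q ^ 2) ^ p * q := by ring
      _ ≤ _ := mul_le_mul_of_nonneg_left (le_add_of_nonneg_right (by positivity)) (by positivity)
  | succ k ih =>
    have hsplit : ∑ j, (A ^ p) i j • v (k + 1) j - (N : ℝ)⁻¹ • ∑ j, x (k + 1) j
        = (∑ j, (A ^ (p + (k + 1))) i j • v k j - (N : ℝ)⁻¹ • ∑ j, x k j)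
          + (∑ j, (A ^ p) i j • (x (k + 1) j - x k j)
            - (N : ℝ)⁻¹ • ∑ j, (x (k + 1) j - x k j)) := by
      simp_rw [hv, add_sub_assoc, smul_add, Finset.sum_add_distrib, sum_pow_smul_consensus,
        Finset.sum_sub_distrib, smul_sub]
      abel
    have hdiff : ∑ j, ‖x (k + 1) j - x k j‖ ≤ 2 * M := by
      calc ∑ j, ‖x (k + 1) j - x k j‖ ≤ ∑ j, (‖x (k + 1) j‖ + ‖x k j‖) :=
            Finset.sum_le_sum fun j _ => norm_sub_le _ _
        _ ≤ 2 * M := by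
            rw [Finset.sum_add_distrib]
            linarith [hM (k + 1), hM k]
    have h1 := ih (p + (k + 1)) i
    have h2 : ‖∑ j, (A ^ p) i j • (x (k + 1) j - x k j)
        - (N : ℝ)⁻¹ • ∑ j, (x (k + 1) j - x k j)‖ ≤ θ * (q ^ 2) ^ p * (2 * M) :=
      (hm.norm_sub_mean_le p _ i).trans (mul_le_mul_of_nonneg_left hdiff (by positivity))
    rw [hsplit]
    set D₁ := ∑ j, (A ^ (p + (k + 1))) i j • v k j - (N : ℝ)⁻¹ • ∑ j, x k j
    set D₂ := ∑ j, (A ^ p) i j • (x (k + 1) j - x k j)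
      - (N : ℝ)⁻¹ • ∑ j, (x (k + 1) j - x k j)
    calc q ^ (k + 1 + 1) * ‖D₁ + D₂‖
        ≤ q ^ (k + 1 + 1) * (‖D₁‖ + ‖D₂‖) :=
          mul_le_mul_of_nonneg_left (norm_add_le _ _) (by positivity)
      _ = q * (q ^ (k + 1) * ‖D₁‖) + q ^ (k + 1 + 1) * ‖D₂‖ := by ring
      _ ≤ q * (M * θ * (q ^ 2) ^ (p + (k + 1)) * (q + 2 / Real.log (1 / q)))
          + q ^ (k + 1 + 1) * (θ * (q ^ 2) ^ p * (2 * M)) := by gcongr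
      _ = M * θ * (q ^ 2) ^ p * (q ^ (2 * k + 3) * (q + 2 / Real.log (1 / q))
          + 2 * q ^ (k + 2)) := by ring
      _ ≤ _ := mul_le_mul_of_nonneg_left (pow_mul_add_le_add_div_log hq0 hq1 k) (by positivity)

/-- Error of the estimates used in iteration `k`, for either way of correcting them. -/
lemma norm_smul_consensus_sub_sum_le {θ q M : ℝ} (hN : 0 < N) (hq0 : 0 < q) (hq1 : q < 1)
    (hm : IsMixingPair A θ (q ^ 2)) {x v : ℕ → Fin N → Vec m} (hM : ∀ k, ∑ j, ‖x k j‖ ≤ M)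
    (h0 : v 0 = x 0)
    (hv : (∀ k i, v (k + 1) i = consensus A k (v k) i + x (k + 1) i - x k i) ∨
      (∀ k i, v (k + 1) i = v k i + x (k + 1) i - x k i)) (k : ℕ) (i : Fin N) :
    ‖(N : ℝ) • consensus A k (v k) i - ∑ j, x k j‖
      ≤ N * (M * θ * (q + 2 / Real.log (1 / q)) * q ^ (k + 1)) := by
  have hN' : (0 : ℝ) < N := by exact_mod_cast hN
  have hM0 : 0 ≤ M := (Finset.sum_nonneg fun j _ => norm_nonneg _).trans (hM 0)
  have hθ := hm.theta_pos
  have ha : 0 < Real.log (1 / q) := Real.log_pos (by rw [lt_div_iff₀ hq0]; linarith)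
  have hmean : (N : ℝ) • consensus A k (v k) i - ∑ j, x k j
      = (N : ℝ) • (∑ j, (A ^ (k + 1)) i j • v k j - (N : ℝ)⁻¹ • ∑ j, x k j) := by
    rw [consensus_apply, smul_sub, smul_smul, mul_inv_cancel₀ hN'.ne', one_smul]
  rw [hmean, norm_smul, Real.norm_of_nonneg hN'.le]
  refine mul_le_mul_of_nonneg_left ?_ hN'.le
  rcases hv with hv | hv
  · have h := norm_sub_mean_le_of_tracking hq0 hq1 hm hM h0 hv k (k + 1) i
    have hqk : 0 < q ^ (k + 1) := by positivity
    refine le_of_mul_le_mul_left (h.trans_eq ?_) hqk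
    ring
  · -- the corrections telescope, so every player averages the current strategies themselves
    have hvx : ∀ k, v k = x k := by
      intro k
      induction k with
      | zero => exact h0
      | succ k ih => funext i; rw [hv, ih]; abel
    rw [hvx]
    refine (hm.norm_sub_mean_le (k + 1) (x k) i).trans ?_
    have h1 : q ^ (k + 1) ≤ q + 2 / Real.log (1 / q) := by
      have h2 : q ^ (k + 1) ≤ q := by
        simpa using pow_le_pow_of_le_one hq0.le hq1.le (show 1 ≤ k + 1 by omega)
      have : 0 < 2 / Real.log (1 / q) := by positivity
      linarith
    calc θ * (q ^ 2) ^ (k + 1) * ∑ j, ‖x k j‖ ≤ θ * (q ^ 2) ^ (k + 1) * M :=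
          mul_le_mul_of_nonneg_left (hM k) (by positivity)
      _ = M * θ * q ^ (k + 1) * q ^ (k + 1) := by ring
      _ ≤ _ := by gcongr

end Consensus

/-! ### Scalar recursions and constants -/

section Scalar

/-- Solution of `E (k + 1) ≤ ϱ E k + c q ^ (k + 1)` when the two rates differ: the larger one
wins, and the ratio of the rates is summed as a geometric series. -/
lemma le_mul_max_pow_of_recursion {E : ℕ → ℝ} {ϱ q c C : ℝ} (hϱ : 0 ≤ ϱ) (hq : 0 < q)
    (hne : q ≠ ϱ) (hc : 0 ≤ c) (hC : 0 ≤ C) (h0 : E 0 ≤ C)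
    (hE : ∀ k, E (k + 1) ≤ ϱ * E k + c * q ^ (k + 1)) (k : ℕ) :
    E k ≤ (C + c / (1 - min (ϱ / q) (q / ϱ))) * max ϱ q ^ k := by
  rcases lt_or_gt_of_ne hne with hlt | hlt
  · have hϱ0 : 0 < ϱ := hq.trans hlt
    have hmin : min (ϱ / q) (q / ϱ) = q / ϱ :=
      min_eq_right (((div_lt_one hϱ0).2 hlt).trans ((one_lt_div hq).2 hlt)).le
    rw [hmin, max_eq_left hlt.le]
    have hr0 : 0 ≤ q / ϱ := by positivity
    have hr1 : 0 < 1 - q / ϱ := sub_pos.2 ((div_lt_one hϱ0).2 hlt)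
    have hqr : q = ϱ * (q / ϱ) := by field_simp
    set r := q / ϱ
    have key : ∀ k, E k ≤ (C + c * ((1 - r ^ k) / (1 - r))) * ϱ ^ k := by
      intro k
      induction k with
      | zero => simpa using h0
      | succ k ih =>
        have h1 : r ^ (k + 1) ≤ r ^ k := pow_le_pow_of_le_one hr0 (by linarith) (by omega)
        have h2 : (1 - r ^ (k + 1)) / (1 - r) = (1 - r ^ k) / (1 - r) + r ^ k := by
          field_simp
          ring
        calc E (k + 1) ≤ ϱ * E k + c * q ^ (k + 1) := hE k
          _ ≤ ϱ * ((C + c * ((1 - r ^ k) / (1 - r))) * ϱ ^ k) + c * (ϱ * r) ^ (k + 1) := by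
              rw [← hqr]; gcongr
          _ = (C + c * ((1 - r ^ k) / (1 - r) + r ^ (k + 1))) * ϱ ^ (k + 1) := by ring
          _ ≤ _ := by rw [h2]; gcongr
    refine (key k).trans ?_
    rw [div_eq_mul_one_div c]
    gcongr
    have : 0 ≤ r ^ k := by positivity
    linarith
  · have hmin : min (ϱ / q) (q / ϱ) = ϱ / q := by
      rcases hϱ.eq_or_lt with h | h
      · simp [← h]
      · exact min_eq_left (((div_lt_one hq).2 hlt).trans ((one_lt_div h).2 hlt)).le
    rw [hmin, max_eq_right hlt.le]
    have hr0 : 0 ≤ ϱ / q := by positivity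
    have hr1 : 0 < 1 - ϱ / q := sub_pos.2 ((div_lt_one hq).2 hlt)
    have hqr : ϱ = q * (ϱ / q) := by field_simp
    set r := ϱ / q
    have key : ∀ k, E k ≤ (C * r ^ k + c * ((1 - r ^ k) / (1 - r))) * q ^ k := by
      intro k
      induction k with
      | zero => simpa using h0
      | succ k ih =>
        have h2 : (1 - r ^ (k + 1)) / (1 - r) = r * ((1 - r ^ k) / (1 - r)) + 1 := by
          field_simp
          ring
        calc E (k + 1) ≤ ϱ * E k + c * q ^ (k + 1) := hE k
          _ ≤ (q * r) * ((C * r ^ k + c * ((1 - r ^ k) / (1 - r))) * q ^ k)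
              + c * q ^ (k + 1) := by rw [← hqr]; gcongr
          _ = _ := by rw [h2]; ring
    refine (key k).trans ?_
    rw [div_eq_mul_one_div c]
    have h3 : 0 ≤ r ^ k := by positivity
    have h4 : C * r ^ k ≤ C := mul_le_of_le_one_right hC (pow_le_one₀ hr0 (by linarith))
    gcongr
    linarith

/-- At equal rates the recursion gives `(C + c k) ϱ ^ k`; a slightly larger rate absorbs the
factor `k`, because `t e ^ (-t) ≤ 1 / e`. -/
lemma le_mul_pow_of_recursion_of_eq {E : ℕ → ℝ} {ϱ ϱ' c C : ℝ} (hϱ : 0 < ϱ) (hϱ' : ϱ < ϱ')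
    (hc : 0 ≤ c) (hC : 0 ≤ C) (h0 : E 0 ≤ C)
    (hE : ∀ k, E (k + 1) ≤ ϱ * E k + c * ϱ ^ (k + 1)) (k : ℕ) :
    E k ≤ (C + c / Real.log ((ϱ' / ϱ) ^ Real.exp 1)) * ϱ' ^ k := by
  have key : ∀ k : ℕ, E k ≤ (C + c * k) * ϱ ^ k := by
    intro k
    induction k with
    | zero => simpa using h0
    | succ k ih =>
      calc E (k + 1) ≤ ϱ * E k + c * ϱ ^ (k + 1) := hE k
        _ ≤ ϱ * ((C + c * k) * ϱ ^ k) + c * ϱ ^ (k + 1) := by gcongr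
        _ = _ := by push_cast; ring
  have hr : 1 < ϱ' / ϱ := (one_lt_div hϱ).2 hϱ'
  have hr0 : 0 < ϱ' / ϱ := by linarith
  have hb : 0 < Real.log (ϱ' / ϱ) := Real.log_pos hr
  have hqr : ϱ' = ϱ * (ϱ' / ϱ) := by field_simp
  rw [Real.log_rpow hr0]
  have h1 : Real.exp 1 * (k * Real.log (ϱ' / ϱ)) ≤ (ϱ' / ϱ) ^ k := by
    have h := Real.add_one_le_exp (k * Real.log (ϱ' / ϱ) - 1)
    have h' : Real.exp (k * Real.log (ϱ' / ϱ)) = (ϱ' / ϱ) ^ k := by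
      rw [mul_comm, Real.exp_mul, Real.exp_log hr0, Real.rpow_natCast]
    rw [← h', show (k : ℝ) * Real.log (ϱ' / ϱ) = 1 + (k * Real.log (ϱ' / ϱ) - 1) by ring,
      Real.exp_add]
    exact mul_le_mul_of_nonneg_left (by linarith) (Real.exp_pos 1).le
  have h2 : (k : ℝ) ≤ (ϱ' / ϱ) ^ k / (Real.exp 1 * Real.log (ϱ' / ϱ)) := by
    rw [le_div_iff₀ (by positivity)]
    linarith
  have h3 : 1 ≤ (ϱ' / ϱ) ^ k := one_le_pow₀ hr.le
  refine (key k).trans ?_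
  calc (C + c * k) * ϱ ^ k
      ≤ (C * (ϱ' / ϱ) ^ k + c * ((ϱ' / ϱ) ^ k / (Real.exp 1 * Real.log (ϱ' / ϱ)))) * ϱ ^ k := by
        gcongr
        exact le_mul_of_one_le_right hC h3
    _ = (C + c / (Real.exp 1 * Real.log (ϱ' / ϱ))) * (ϱ * (ϱ' / ϱ)) ^ k := by
        rw [mul_pow]; ring
    _ = _ := by rw [← hqr]

lemma one_div_batchSize_le {q : ℝ} (hq : 0 < q) (k : ℕ) :
    1 / (batchSize (q ^ 2) k : ℝ) ≤ q ^ (k + 1) := by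
  have h : (q ^ 2) ^ (-(((k : ℝ) + 1) / 2)) = (q ^ (k + 1))⁻¹ := by
    rw [← Real.rpow_natCast, ← Real.rpow_mul hq.le, ← Real.rpow_natCast, ← Real.rpow_neg hq.le]
    congr 1
    push_cast
    ring
  have h1 := Nat.le_ceil ((q ^ 2) ^ (-(((k : ℝ) + 1) / 2)))
  rw [batchSize, one_div]
  refine inv_le_of_inv_le₀ (by positivity) ?_
  rwa [h] at h1 ⊢

variable {N : ℕ}

lemma constC1_ge {M θ β : ℝ} (hM : 0 ≤ M) (hθ : 0 ≤ θ) : M * θ ≤ constC1 M θ β := by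
  rw [constC1]
  refine le_mul_of_one_le_right (by positivity) (le_add_of_nonneg_right ?_)
  positivity

lemma constC2_eq {M θ q : ℝ} : constC2 M θ (q ^ 2) = M * θ * (2 / Real.log (1 / q)) := by
  rw [constC2, one_div, one_div, ← inv_pow, Real.log_pow]
  push_cast
  ring

/-- The perturbations of one iteration, with consensus error `N M θ (q + 2 / ln (1/q)) q ^ (k+1)`,
are bounded by `C₃ q ^ (k + 1)`, where `q = √β`. -/
lemma perturbation_le_constC3 {M θ q α : ℝ} {ν Lᵢ : Fin N → ℝ} (hM : 0 ≤ M) (hθ : 0 ≤ θ)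
    (hα : 0 ≤ α) (hq0 : 0 < q) (hq1 : q < 1) (hL : ∀ i, 0 ≤ Lᵢ i) (k : ℕ) :
    4 * α * M * (N * (M * θ * (q + 2 / Real.log (1 / q)) * q ^ (k + 1))) * ∑ i, Lᵢ i
      + 2 * α ^ 2 * (N * (M * θ * (q + 2 / Real.log (1 / q)) * q ^ (k + 1))) ^ 2 * ∑ i, Lᵢ i ^ 2
      + α ^ 2 * ((∑ i, ν i ^ 2) * q ^ (k + 1))
      ≤ constC3 M θ (q ^ 2) α ν Lᵢ * q ^ (k + 1) := by
  have ha : 0 < Real.log (1 / q) := Real.log_pos (by rw [lt_div_iff₀ hq0]; linarith)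
  have h1 : (q ^ 2) ^ (1 / 2 : ℝ) = q := by
    rw [← Real.sqrt_eq_rpow, Real.sqrt_sq hq0.le]
  have h3 : (q ^ 2) ^ (3 / 2 : ℝ) = q ^ 3 := by
    rw [← Real.rpow_natCast, ← Real.rpow_mul hq0.le, ← Real.rpow_natCast]
    norm_num
  have hC1 : M * θ ≤ constC1 M θ (q ^ 2) := constC1_ge hM hθ
  have hC10 : 0 ≤ constC1 M θ (q ^ 2) := (by positivity : 0 ≤ M * θ).trans hC1
  have hC20 : 0 ≤ constC2 M θ (q ^ 2) := by rw [constC2_eq]; positivity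
  rw [constC3, h1, h3]
  have hS : M * θ * (q + 2 / Real.log (1 / q))
      ≤ constC1 M θ (q ^ 2) * q + constC2 M θ (q ^ 2) := by
    rw [mul_add, constC2_eq]
    gcongr
  have hS0 : 0 ≤ M * θ * (q + 2 / Real.log (1 / q)) := by positivity
  set S := M * θ * (q + 2 / Real.log (1 / q))
  set C₁ := constC1 M θ (q ^ 2)
  set C₂ := constC2 M θ (q ^ 2)
  have hL1 : 0 ≤ ∑ i, Lᵢ i := Finset.sum_nonneg fun i _ => hL i
  have hL2 : 0 ≤ ∑ i, Lᵢ i ^ 2 := Finset.sum_nonneg fun i _ => sq_nonneg _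
  have hqk : q ^ (k + 1) ≤ q := by
    simpa using pow_le_pow_of_le_one hq0.le hq1.le (show 1 ≤ k + 1 by omega)
  have hS2 : S ^ 2 * q ^ (k + 1) ≤ 2 * (C₁ ^ 2 * q ^ 3 + C₂ ^ 2 * q) := by
    calc S ^ 2 * q ^ (k + 1) ≤ (C₁ * q + C₂) ^ 2 * q := by gcongr
      _ ≤ (2 * ((C₁ * q) ^ 2 + C₂ ^ 2)) * q := by gcongr; exact add_sq_le
      _ = _ := by ring
  calc _ = (4 * α * M * N * S * ∑ i, Lᵢ i
        + 2 * α ^ 2 * N ^ 2 * (S ^ 2 * q ^ (k + 1)) * ∑ i, Lᵢ i ^ 2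
        + α ^ 2 * ∑ i, ν i ^ 2) * q ^ (k + 1) := by ring
    _ ≤ (4 * α * M * N * (C₁ * q + C₂) * ∑ i, Lᵢ i
        + 2 * α ^ 2 * N ^ 2 * (2 * (C₁ ^ 2 * q ^ 3 + C₂ ^ 2 * q)) * ∑ i, Lᵢ i ^ 2
        + α ^ 2 * ∑ i, ν i ^ 2) * q ^ (k + 1) := by gcongr
    _ = _ := by ring

lemma constC3_nonneg {M θ q α : ℝ} {ν Lᵢ : Fin N → ℝ} (hM : 0 ≤ M) (hθ : 0 ≤ θ)
    (hα : 0 ≤ α) (hq0 : 0 < q) (hq1 : q < 1) (hL : ∀ i, 0 ≤ Lᵢ i) :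
    0 ≤ constC3 M θ (q ^ 2) α ν Lᵢ := by
  have ha : 0 < Real.log (1 / q) := Real.log_pos (by rw [lt_div_iff₀ hq0]; linarith)
  have hL1 : 0 ≤ ∑ i, Lᵢ i := Finset.sum_nonneg fun i _ => hL i
  have hC1 : 0 ≤ constC1 M θ (q ^ 2) := (by positivity : 0 ≤ M * θ).trans (constC1_ge hM hθ)
  have hC2 : 0 ≤ constC2 M θ (q ^ 2) := by rw [constC2_eq]; positivity
  rw [constC3]
  positivity

end Scalar

/-! ### One gradient step without noise -/

section Step

variable {N m : ℕ}

lemma sqNorm_nonneg (x : Fin N → Vec m) : 0 ≤ sqNorm x :=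
  Finset.sum_nonneg fun _ _ => sq_nonneg _

lemma profInner_le_sqrt_mul_sqrt (x y : Fin N → Vec m) :
    profInner x y ≤ √(sqNorm x) * √(sqNorm y) :=
  (Finset.sum_le_sum fun i _ => real_inner_le_norm (x i) (y i)).trans
    (Real.sum_mul_le_sqrt_mul_sqrt _ (fun i => ‖x i‖) (fun i => ‖y i‖))

/-- A perturbed forward step along a strongly monotone Lipschitz field contracts, up to terms in
the perturbation `δ`. -/
lemma sum_norm_sub_smul_sq_le {α η L : ℝ} (hα : 0 ≤ α) {a b δ : Fin N → Vec m}
    (hmono : η * sqNorm a ≤ profInner b a) (hlip : sqNorm b ≤ L ^ 2 * sqNorm a) :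
    ∑ i, ‖a i - α • (b i + δ i)‖ ^ 2
      ≤ contraction α η L * sqNorm a
        + (2 * α * ∑ i, ‖a i‖ * ‖δ i‖ + 2 * α ^ 2 * ∑ i, ‖δ i‖ ^ 2) := by
  have hi : ∀ i, ‖a i - α • (b i + δ i)‖ ^ 2
      ≤ ‖a i‖ ^ 2 - 2 * α * inner ℝ (b i) (a i) + 2 * α ^ 2 * ‖b i‖ ^ 2
        + 2 * α * (‖a i‖ * ‖δ i‖) + 2 * α ^ 2 * ‖δ i‖ ^ 2 := by
    intro i
    have h1 : ‖b i + δ i‖ ^ 2 ≤ 2 * (‖b i‖ ^ 2 + ‖δ i‖ ^ 2) :=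
      (pow_le_pow_left₀ (norm_nonneg _) (norm_add_le _ _) 2).trans add_sq_le
    have h2 : -inner ℝ (a i) (δ i) ≤ ‖a i‖ * ‖δ i‖ :=
      (neg_le_abs _).trans (abs_real_inner_le_norm _ _)
    rw [norm_sub_sq_real, inner_smul_right, inner_add_right, norm_smul, mul_pow,
      Real.norm_eq_abs, sq_abs, real_inner_comm (a i) (b i)]
    have h3 := mul_le_mul_of_nonneg_left h1 (sq_nonneg α)
    have h4 := mul_le_mul_of_nonneg_left h2 hα
    linarith
  refine (Finset.sum_le_sum fun i _ => hi i).trans ?_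
  simp only [Finset.sum_add_distrib, Finset.sum_sub_distrib, ← Finset.mul_sum]
  have h5 := mul_le_mul_of_nonneg_left hmono hα
  have h6 := mul_le_mul_of_nonneg_left hlip (sq_nonneg α)
  simp only [sqNorm, profInner, contraction] at *
  linarith

end Step

/-! ### Strategy profiles of a regular game -/

namespace AggGame

variable {N m d : ℕ} {Ω : Type*} [MeasurableSpace Ω] {g : AggGame N m d} {P : Measure Ω}
  {ξ : Ω → Vec d} {Y : Set (Vec m)}

lemma sum_norm_le_radius (hreg : g.Regular P ξ Y) {x : Fin N → Vec m} (hx : x ∈ g.profiles) :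
    ∑ i, ‖x i‖ ≤ g.radius :=
  Finset.sum_le_sum fun i _ => le_csSup ((hreg.dom_compact i).image continuous_norm).bddAbove
    ⟨x i, hx i, rfl⟩

lemma norm_sub_le_radius (hreg : g.Regular P ξ Y) {x y : Fin N → Vec m} (hx : x ∈ g.profiles)
    (hy : y ∈ g.profiles) (i : Fin N) : ‖x i - y i‖ ≤ 2 * g.radius := by
  have h : ∀ z ∈ g.profiles, ‖z i‖ ≤ g.radius := fun z hz =>
    (Finset.single_le_sum (f := fun i => ‖z i‖) (fun _ _ => norm_nonneg _)
      (Finset.mem_univ i)).trans (sum_norm_le_radius hreg hz)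
  linarith [norm_sub_le (x i) (y i), h x hx, h y hy]

lemma sqNorm_sub_le_radius (hreg : g.Regular P ξ Y) {x y : Fin N → Vec m} (hx : x ∈ g.profiles)
    (hy : y ∈ g.profiles) : sqNorm (x - y) ≤ N * (2 * g.radius) ^ 2 := by
  refine (Finset.sum_le_sum fun i _ => pow_le_pow_left₀ (norm_nonneg _)
    (norm_sub_le_radius hreg hx hy i) 2).trans_eq ?_
  simp

/-- `ϱ` can be nonpositive only if there is a single profile: otherwise `η ≤ L`. -/
lemma contraction_pos_of_ne {η L α : ℝ} {Lᵢ : Fin N → ℝ}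
    (hgrad : g.GradientBounds P ξ Y η L Lᵢ) (hη : 0 < η) {x y : Fin N → Vec m}
    (hx : x ∈ g.profiles) (hy : y ∈ g.profiles) (hne : sqNorm (x - y) ≠ 0) :
    0 < contraction α η L := by
  have hs : 0 < sqNorm (x - y) := (sqNorm_nonneg _).lt_of_ne' hne
  have h1 := (hgrad.strongly_monotone x hx y hy).trans (profInner_le_sqrt_mul_sqrt _ _)
  have h2 := mul_le_mul_of_nonneg_right (hgrad.lipschitz x hx y hy)
    (Real.sqrt_nonneg (sqNorm (x - y)))
  rw [mul_assoc, Real.mul_self_sqrt hs.le] at h2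
  have h3 : η ≤ L := le_of_mul_le_mul_right (h1.trans h2) hs
  have h4 : α ^ 2 * η ^ 2 ≤ α ^ 2 * L ^ 2 := by gcongr
  rw [contraction]
  nlinarith [sq_nonneg (1 - 2 * (α * η))]

end AggGame

/-! ### Conditionally unbiased noise -/

section Noise

variable {m : ℕ} {Ω : Type*} {m₀ mΩ : MeasurableSpace Ω} {P : Measure Ω} [IsProbabilityMeasure P]

lemma integrable_norm_sq_of_bound {F : Ω → Vec m} (hF : AEStronglyMeasurable F P) {B : ℝ}
    (hB : ∀ ω, ‖F ω‖ ≤ B) : Integrable (fun ω => ‖F ω‖ ^ 2) P :=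
  (MemLp.of_bound (p := (2 : ℕ)) hF B (ae_of_all _ hB)).integrable_norm_pow two_ne_zero

/-- Noise that is conditionally centred with respect to a σ-algebra is orthogonal in `L²` to bounded
vectors measurable with respect to it. -/
lemma integral_norm_sub_smul_sq (hm : m₀ ≤ mΩ) {F e : Ω → Vec m} (hF : StronglyMeasurable[m₀] F)
    {B : ℝ} (hB : ∀ ω, ‖F ω‖ ≤ B) (he : MemLp e 2 P) (hcond : P[e | m₀] =ᵐ[P] 0) (α : ℝ) :
    Integrable (fun ω => ‖F ω - α • e ω‖ ^ 2) P ∧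
    ∫ ω, ‖F ω - α • e ω‖ ^ 2 ∂P = ∫ ω, ‖F ω‖ ^ 2 ∂P + α ^ 2 * ∫ ω, ‖e ω‖ ^ 2 ∂P := by
  have hF' : AEStronglyMeasurable F P := (hF.mono hm).aestronglyMeasurable
  have hFi := integrable_norm_sq_of_bound hF' hB
  have he1 : Integrable e P := he.integrable one_le_two
  have he2 : Integrable (fun ω => ‖e ω‖ ^ 2) P := by
    have : MemLp e ((2 : ℕ) : ENNReal) P := by exact_mod_cast he
    exact this.integrable_norm_pow two_ne_zero
  have hinner : Integrable (fun ω => inner ℝ (F ω) (e ω)) P := by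
    refine (he1.norm.const_mul B).mono' (hF'.inner he1.aestronglyMeasurable)
      (ae_of_all _ fun ω => ?_)
    exact (norm_inner_le_norm _ _).trans (mul_le_mul_of_nonneg_right (hB ω) (norm_nonneg _))
  have hzero : ∫ ω, inner ℝ (F ω) (e ω) ∂P = 0 := by
    have h := condExp_bilin_of_stronglyMeasurable_left (μ := P)
      (innerSL ℝ : Vec m →L[ℝ] Vec m →L[ℝ] ℝ) hF hinner he1
    have h' : P[fun ω => inner ℝ (F ω) (e ω) | m₀] =ᵐ[P] 0 := by
      refine h.trans ?_
      filter_upwards [hcond] with ω hω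
      rw [hω]
      simp
    rw [← integral_condExp hm, integral_congr_ae h']
    simp
  have hexp : (fun ω => ‖F ω - α • e ω‖ ^ 2)
      = fun ω => (‖F ω‖ ^ 2 - 2 * α * inner ℝ (F ω) (e ω)) + α ^ 2 * ‖e ω‖ ^ 2 := by
    funext ω
    rw [norm_sub_sq_real, inner_smul_right, norm_smul, mul_pow, Real.norm_eq_abs, sq_abs]
    ring
  have hsub : Integrable (fun ω => ‖F ω‖ ^ 2 - 2 * α * inner ℝ (F ω) (e ω)) P :=
    hFi.sub (hinner.const_mul _)
  rw [hexp]
  refine ⟨hsub.add (he2.const_mul _), ?_⟩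
  rw [integral_add hsub (he2.const_mul _), integral_sub hFi (hinner.const_mul _),
    integral_const_mul, integral_const_mul, hzero]
  ring

end Noise

/-! ### The iterates of the scheme -/

section Iterates

lemma Measurable.comp_prodMk_of_mem {Ω E F : Type*} [MeasurableSpace E] [MeasurableSpace F]
    {m₀ : MeasurableSpace Ω} {S : Set (E × E)} {f : E → E → F}
    (hf : Measurable fun p : S => f p.1.1 p.1.2) {a b : Ω → E} (ha : Measurable[m₀] a)
    (hb : Measurable[m₀] b) (hab : ∀ ω, (a ω, b ω) ∈ S) : Measurable[m₀] fun ω => f (a ω) (b ω) :=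
  hf.comp ((ha.prodMk hb).subtype_mk (h := hab))

lemma measurable_history {N m : ℕ} {Ω : Type*} {x : ℕ → Ω → Fin N → Vec m} {l k : ℕ} (hlk : l ≤ k) :
    Measurable[history x k] (x l) :=
  (comap_measurable (x l)).mono (le_iSup₂_of_le l hlk le_rfl) le_rfl

lemma measurable_consensus {N m : ℕ} {Ω : Type*} {A : Matrix (Fin N) (Fin N) ℝ}
    {m₀ : MeasurableSpace Ω} {w : Ω → Fin N → Vec m}
    (hw : Measurable[m₀] w) (k : ℕ) : Measurable[m₀] fun ω => consensus A k (w ω) := by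
  refine measurable_pi_lambda _ fun i => ?_
  simp_rw [consensus_apply]
  exact Finset.measurable_sum _ fun j _ =>
    (measurable_const_smul ((A ^ (k + 1)) i j)).comp ((measurable_pi_apply j).comp hw)

lemma history_mono {N m : ℕ} {Ω : Type*} {x : ℕ → Ω → Fin N → Vec m} {l k : ℕ} (hlk : l ≤ k) :
    history x l ≤ history x k :=
  iSup₂_le fun j hj => le_iSup₂_of_le j (hj.trans hlk) le_rfl

variable {N m d : ℕ} {Ω : Type*} [MeasurableSpace Ω] {g : AggGame N m d} {P : Measure Ω}
  {ξ : Ω → Vec d} {ξs : ℕ → ℕ → Ω → Vec d} {A : Matrix (Fin N) (Fin N) ℝ} {α β : ℝ}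
  {x v : ℕ → Ω → Fin N → Vec m} {Y : Set (Vec m)}

lemma IsDistributedVSPGR.mem_profiles (h : IsDistributedVSPGR g P ξ ξs A α β x v) (k : ℕ)
    (ω : Ω) : x k ω ∈ g.profiles := by
  induction k with
  | zero => exact h.x_zero_mem ω
  | succ k ih => exact fun i => (h.x_succ k ω i).dom (ih i)

lemma IsDistributedVSPGR.measurable_v (h : IsDistributedVSPGR g P ξ ξs A α β x v) (k : ℕ) :
    Measurable[history x k] (v k) := by
  induction k with
  | zero =>
    rw [show v 0 = x 0 from funext h.v_zero]
    exact measurable_history le_rfl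
  | succ k ih =>
    have ih' : Measurable[history x (k + 1)] (v k) := ih.mono (history_mono k.le_succ) le_rfl
    have h1 : Measurable[history x (k + 1)] (x (k + 1)) := measurable_history le_rfl
    have h0 : Measurable[history x (k + 1)] (x k) := measurable_history k.le_succ
    rcases h.v_succ with hv | hv
    · rw [show v (k + 1) = fun ω => consensus A k (v k ω) + x (k + 1) ω - x k ω from
        funext fun ω => funext fun i => hv k ω i]
      exact ((measurable_consensus ih' k).add h1).sub h0
    · rw [show v (k + 1) = fun ω => v k ω + x (k + 1) ω - x k ω from
        funext fun ω => funext fun i => hv k ω i]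
      exact (ih'.add h1).sub h0

lemma IsDistributedVSPGR.history_le (h : IsDistributedVSPGR g P ξ ξs A α β x v) (k : ℕ) :
    history x k ≤ ‹MeasurableSpace Ω› :=
  iSup₂_le fun l _ => (h.measurable_x l).comap_le

lemma IsDistributedVSPGR.measurable_grad (h : IsDistributedVSPGR g P ξ ξs A α β x v)
    (hreg : g.Regular P ξ Y) (hYv : ∀ k ω i, (N : ℝ) • consensus A k (v k ω) i ∈ Y)
    (k : ℕ) (i : Fin N) : Measurable[history x k]
      fun ω => g.grad P ξ i (x k ω i) ((N : ℝ) • consensus A k (v k ω) i) := by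
  have hx : Measurable[history x k] fun ω => x k ω i :=
    (measurable_pi_apply i).comp (measurable_history le_rfl)
  have hv : Measurable[history x k] fun ω => (N : ℝ) • consensus A k (v k ω) i :=
    (measurable_const_smul (N : ℝ)).comp
      ((measurable_pi_apply i).comp (measurable_consensus (h.measurable_v k) k))
  exact (hreg.grad_measurable i).comp_prodMk_of_mem hx hv fun ω =>
    ⟨h.mem_profiles k ω i, hYv k ω i⟩

variable [IsProbabilityMeasure P]

lemma IsDistributedVSPGR.integrable_sqNorm (h : IsDistributedVSPGR g P ξ ξs A α β x v)
    (hreg : g.Regular P ξ Y) {xstar : Fin N → Vec m} (hstar : xstar ∈ g.profiles) (k : ℕ) :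
    Integrable (fun ω => sqNorm (x k ω - xstar)) P :=
  integrable_finsetSum _ fun i _ => integrable_norm_sq_of_bound
    (((measurable_pi_apply i).comp (h.measurable_x k)).sub_const (xstar i)).aestronglyMeasurable
    fun ω => AggGame.norm_sub_le_radius hreg (h.mem_profiles k ω) hstar i

lemma NoiseCondition.integral_norm_sq_le {e : Fin N → ℕ → Ω → Vec m} {ν : Fin N → ℝ}
    (hnoise : NoiseCondition P x e β ν) {k : ℕ} (hle : history x k ≤ ‹MeasurableSpace Ω›)
    (i : Fin N) : ∫ ω, ‖e i k ω‖ ^ 2 ∂P ≤ ν i ^ 2 / (batchSize β k : ℝ) := by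
  rw [← integral_condExp hle]
  refine (integral_mono_ae integrable_condExp (integrable_const _) (hnoise.variance i k)).trans_eq
    ?_
  simp

/-- The contraction estimate for one iteration, where `D` bounds the errors of the estimates of
the aggregate. -/
lemma IsDistributedVSPGR.meanSqError_succ_le (h : IsDistributedVSPGR g P ξ ξs A α β x v)
    (hreg : g.Regular P ξ Y) (hY : g.aggregates ⊆ Y)
    (hYv : ∀ k ω i, (N : ℝ) • consensus A k (v k ω) i ∈ Y)
    {η L : ℝ} {Lᵢ : Fin N → ℝ} (hgrad : g.GradientBounds P ξ Y η L Lᵢ)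
    {xstar : Fin N → Vec m} (hstar : g.IsNash P ξ xstar) (hα : 0 < α)
    {ν : Fin N → ℝ} (hnoise : NoiseCondition P x (errorProc g P ξ ξs A β x v) β ν)
    {k : ℕ} {D : ℝ} (hD : ∀ ω i, ‖(N : ℝ) • consensus A k (v k ω) i - ∑ j, x k ω j‖ ≤ D) :
    meanSqError P x xstar (k + 1) ≤ contraction α η L * meanSqError P x xstar k
      + (4 * α * g.radius * D * ∑ i, Lᵢ i + 2 * α ^ 2 * D ^ 2 * ∑ i, Lᵢ i ^ 2)
      + α ^ 2 * ((∑ i, ν i ^ 2) * (1 / (batchSize β k : ℝ))) := by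
  set c := 4 * α * g.radius * D * ∑ i, Lᵢ i + 2 * α ^ 2 * D ^ 2 * ∑ i, Lᵢ i ^ 2
  have hmem := h.mem_profiles k
  -- `F` is the difference of the noiseless forward steps taken at `x k` and at `xstar`
  let F : Fin N → Ω → Vec m := fun i ω =>
    x k ω i - α • g.grad P ξ i (x k ω i) ((N : ℝ) • consensus A k (v k ω) i)
      - (xstar i - α • g.pseudoGrad P ξ xstar i)
  have hFmeas : ∀ i, StronglyMeasurable[history x k] (F i) := by
    intro i
    have hx : Measurable[history x k] fun ω => x k ω i :=
      (measurable_pi_apply i).comp (measurable_history le_rfl)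
    have hgr := (measurable_const_smul α).comp (h.measurable_grad hreg hYv k i)
    exact ((hx.sub hgr).sub_const _).stronglyMeasurable
  have hFle : ∀ ω, ∑ i, ‖F i ω‖ ^ 2 ≤ contraction α η L * sqNorm (x k ω - xstar) + c := by
    intro ω
    let b := g.pseudoGrad P ξ (x k ω) - g.pseudoGrad P ξ xstar
    let δ : Fin N → Vec m := fun i =>
      g.grad P ξ i (x k ω i) ((N : ℝ) • consensus A k (v k ω) i) - g.pseudoGrad P ξ (x k ω) i
    have hδ : ∀ i, ‖δ i‖ ≤ Lᵢ i * D := fun i =>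
      (hgrad.lipschitz_agg i _ (hmem ω i) _ (hYv k ω i) _ (hY ⟨x k ω, hmem ω, rfl⟩)).trans
        (mul_le_mul_of_nonneg_left (hD ω i) (hgrad.Li_nonneg i))
    have hlip : sqNorm b ≤ L ^ 2 * sqNorm (x k ω - xstar) := by
      have h1 := hgrad.lipschitz _ (hmem ω) _ hstar.1
      have h2 := pow_le_pow_left₀ (Real.sqrt_nonneg _) h1 2
      rwa [mul_pow, Real.sq_sqrt (sqNorm_nonneg _), Real.sq_sqrt (sqNorm_nonneg _)] at h2
    have hstep := sum_norm_sub_smul_sq_le hα.le (δ := δ)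
      (hgrad.strongly_monotone _ (hmem ω) _ hstar.1) hlip
    have hFeq : ∀ i, F i ω = (x k ω - xstar) i - α • (b i + δ i) := by
      intro i
      simp only [F, b, δ, Pi.sub_apply, smul_add, smul_sub]
      abel
    simp_rw [hFeq]
    refine hstep.trans (add_le_add_right (add_le_add ?_ ?_) _)
    · have : ∑ i, ‖(x k ω - xstar) i‖ * ‖δ i‖ ≤ ∑ i, (2 * g.radius) * (Lᵢ i * D) := by
        refine Finset.sum_le_sum fun i _ => ?_
        have h1 := AggGame.norm_sub_le_radius hreg (hmem ω) hstar.1 i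
        exact mul_le_mul h1 (hδ i) (norm_nonneg _) ((norm_nonneg _).trans h1)
      rw [← Finset.mul_sum, ← Finset.sum_mul] at this
      calc 2 * α * ∑ i, ‖(x k ω - xstar) i‖ * ‖δ i‖
          ≤ 2 * α * (2 * g.radius * ((∑ i, Lᵢ i) * D)) := by gcongr
        _ = _ := by ring
    · have : ∑ i, ‖δ i‖ ^ 2 ≤ ∑ i, (Lᵢ i * D) ^ 2 :=
        Finset.sum_le_sum fun i _ => pow_le_pow_left₀ (norm_nonneg _) (hδ i) 2
      simp_rw [mul_pow] at this
      rw [← Finset.sum_mul] at this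
      calc 2 * α ^ 2 * ∑ i, ‖δ i‖ ^ 2 ≤ 2 * α ^ 2 * ((∑ i, Lᵢ i ^ 2) * D ^ 2) := by gcongr
        _ = _ := by ring
  have hFbdd : ∀ i ω, ‖F i ω‖ ≤ √(|contraction α η L| * (N * (2 * g.radius) ^ 2) + c) := by
    intro i ω
    refine Real.le_sqrt_of_sq_le ?_
    have h1 : ‖F i ω‖ ^ 2 ≤ ∑ i, ‖F i ω‖ ^ 2 :=
      Finset.single_le_sum (f := fun i => ‖F i ω‖ ^ 2) (fun _ _ => sq_nonneg _)
        (Finset.mem_univ i)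
    have h2 := AggGame.sqNorm_sub_le_radius hreg (hmem ω) hstar.1
    have h3 : contraction α η L * sqNorm (x k ω - xstar)
        ≤ |contraction α η L| * (N * (2 * g.radius) ^ 2) :=
      mul_le_mul (le_abs_self _) h2 (sqNorm_nonneg _) (abs_nonneg _)
    linarith [hFle ω]
  have hprox : ∀ ω i, ‖x (k + 1) ω i - xstar i‖
      ≤ ‖F i ω - α • errorProc g P ξ ξs A β x v i k ω‖ := by
    intro ω i
    refine (IsProx.norm_sub_le (hreg.r_ne_bot i) (hreg.r_convex i) hα (h.x_succ k ω i)
      (hstar.1 i) (hstar.toReal_le_add_inner hreg i)).trans_eq ?_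
    congr 1
    simp only [F, smul_add]
    abel
  have hint := fun i => integral_norm_sub_smul_sq (h.history_le k) (hFmeas i) (hFbdd i)
    (hnoise.memLp i k) (hnoise.unbiased i k) α
  have hFint : ∀ i, Integrable (fun ω => ‖F i ω‖ ^ 2) P := fun i =>
    integrable_norm_sq_of_bound ((hFmeas i).mono (h.history_le k)).aestronglyMeasurable (hFbdd i)
  have hsq := h.integrable_sqNorm hreg hstar.1
  calc meanSqError P x xstar (k + 1)
      ≤ ∫ ω, ∑ i, ‖F i ω - α • errorProc g P ξ ξs A β x v i k ω‖ ^ 2 ∂P :=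
        integral_mono (hsq (k + 1)) (integrable_finsetSum _ fun i _ => (hint i).1) fun ω =>
          Finset.sum_le_sum fun i _ => pow_le_pow_left₀ (norm_nonneg _) (hprox ω i) 2
    _ = ∫ ω, ∑ i, ‖F i ω‖ ^ 2 ∂P
        + α ^ 2 * ∑ i, ∫ ω, ‖errorProc g P ξ ξs A β x v i k ω‖ ^ 2 ∂P := by
        rw [integral_finsetSum _ fun i _ => (hint i).1, integral_finsetSum _ fun i _ => hFint i,
          Finset.sum_congr rfl fun i _ => (hint i).2, Finset.sum_add_distrib, ← Finset.mul_sum]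
    _ ≤ (contraction α η L * meanSqError P x xstar k + c)
        + α ^ 2 * ((∑ i, ν i ^ 2) * (1 / (batchSize β k : ℝ))) := by
        refine add_le_add ?_ (mul_le_mul_of_nonneg_left ?_ (sq_nonneg α))
        · refine (integral_mono (integrable_finsetSum _ fun i _ => hFint i)
            (((hsq k).const_mul _).add (integrable_const c)) hFle).trans_eq ?_
          simp only [Pi.add_apply]
          rw [integral_add ((hsq k).const_mul _) (integrable_const c), integral_const_mul]
          simp [meanSqError]
        · rw [Finset.sum_mul]
          refine Finset.sum_le_sum fun i _ => ?_
          rw [mul_one_div]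
          exact hnoise.integral_norm_sq_le (h.history_le k) i
    _ = _ := by ring

end Iterates

/-! ### Convergence rates -/

theorem theorem3 {N m d : ℕ} {Ω : Type*} [MeasurableSpace Ω]
    (P : Measure Ω) [IsProbabilityMeasure P] (ξ : Ω → Vec d)
    (g : AggGame N m d) (Y : Set (Vec m)) (hY : g.aggregates ⊆ Y)
    (hreg : g.Regular P ξ Y)
    (η L : ℝ) (Lᵢ : Fin N → ℝ) (hgrad : g.GradientBounds P ξ Y η L Lᵢ)
    (G : SimpleGraph (Fin N)) (hG : G.Connected)
    (A : Matrix (Fin N) (Fin N) ℝ) (hA : IsWeightMatrix G A)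
    (xstar : Fin N → Vec m) (hstar : g.IsNash P ξ xstar)
    (α : ℝ) (hα : α ∈ Set.Ioo 0 (η / L ^ 2)) :
    (((∃ i, 0 < A i i) ∨ ¬ G.Colorable 2) → ∃ θ β : ℝ, IsMixingPair A θ β) ∧
    ∀ (θ β : ℝ), IsMixingPair A θ β →
    ∀ (ξs : ℕ → ℕ → Ω → Vec d) (x v : ℕ → Ω → Fin N → Vec m),
      IsDistributedVSPGR g P ξ ξs A α β x v →
      (∀ k ω i, (N : ℝ) • consensus A k (v k ω) i ∈ Y) →
    ∀ (ν : Fin N → ℝ), NoiseCondition P x (errorProc g P ξ ξs A β x v) β ν →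
    ∀ (C : ℝ), 0 < C → meanSqError P x xstar 0 ≤ C →
      (∀ k, Integrable (fun ω => sqNorm (x k ω - xstar)) P) ∧
      (β ≠ contraction α η L ^ 2 → ∀ k : ℕ,
        meanSqError P x xstar k
          ≤ (C + constC3 g.radius θ β α ν Lᵢ
              / (1 - min (contraction α η L / Real.sqrt β) (Real.sqrt β / contraction α η L)))
            * max (contraction α η L) (Real.sqrt β) ^ k) ∧
      (β = contraction α η L ^ 2 → 0 < contraction α η L →
        ∀ ϱ' ∈ Set.Ioo (contraction α η L) 1, ∀ k : ℕ,
        meanSqError P x xstar k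
          ≤ (C + constC3 g.radius θ β α ν Lᵢ
              / Real.log ((ϱ' / contraction α η L) ^ Real.exp 1)) * ϱ' ^ k) := by
  refine ⟨hA.exists_isMixingPair hG, ?_⟩
  intro θ β hm ξs x v hx hYv ν hnoise C hC hC0
  obtain ⟨hα0, hα1⟩ := hα
  have hL := hgrad.L_pos
  have hη : 0 < η := by
    have := hα0.trans hα1
    rwa [div_pos_iff_of_pos_right (by positivity)] at this
  have hint := hx.integrable_sqNorm (P := P) hreg hstar.1
  -- all rates are expressed through `q = √β`
  obtain ⟨q, hq0, hq1, rfl⟩ : ∃ q : ℝ, 0 < q ∧ q < 1 ∧ β = q ^ 2 := by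
    refine ⟨√β, Real.sqrt_pos.2 hm.beta_pos, ?_, (Real.sq_sqrt hm.beta_pos.le).symm⟩
    rw [Real.sqrt_lt' one_pos]
    simpa using hm.beta_lt_one
  rw [Real.sqrt_sq hq0.le]
  have hM : 0 ≤ g.radius :=
    (Finset.sum_nonneg fun i _ => norm_nonneg _).trans (AggGame.sum_norm_le_radius hreg hstar.1)
  have hθ := hm.theta_pos.le
  have hN : 0 < N := Fin.pos_iff_nonempty.2 hG.nonempty
  have hC3 : 0 ≤ constC3 g.radius θ (q ^ 2) α ν Lᵢ :=
    constC3_nonneg hM hθ hα0.le hq0 hq1 hgrad.Li_nonneg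
  set ϱ := contraction α η L with hϱdef
  have hrec : ∀ k, meanSqError P x xstar (k + 1) ≤ ϱ * meanSqError P x xstar k
      + constC3 g.radius θ (q ^ 2) α ν Lᵢ * q ^ (k + 1) := by
    intro k
    have hD : ∀ ω i, ‖(N : ℝ) • consensus A k (v k ω) i - ∑ j, x k ω j‖
        ≤ N * (g.radius * θ * (q + 2 / Real.log (1 / q)) * q ^ (k + 1)) := fun ω i =>
      norm_smul_consensus_sub_sum_le hN hq0 hq1 hm (x := fun k => x k ω) (v := fun k => v k ω)
        (fun k => AggGame.sum_norm_le_radius hreg (hx.mem_profiles k ω)) (hx.v_zero ω)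
        (hx.v_succ.imp (fun h k i => h k ω i) (fun h k i => h k ω i)) k i
    have h1 := hx.meanSqError_succ_le hreg hY hYv hgrad hstar hα0 hnoise hD
    have h2 := perturbation_le_constC3 (ν := ν) hM hθ hα0.le hq0 hq1 hgrad.Li_nonneg k
    have h3 : α ^ 2 * ((∑ i, ν i ^ 2) * (1 / (batchSize (q ^ 2) k : ℝ)))
        ≤ α ^ 2 * ((∑ i, ν i ^ 2) * q ^ (k + 1)) := by
      have := one_div_batchSize_le hq0 k
      have : 0 ≤ ∑ i, ν i ^ 2 := Finset.sum_nonneg fun i _ => sq_nonneg _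
      gcongr
    linarith
  refine ⟨hint, fun hne k => ?_, fun heq hϱ ϱ' hϱ' k => ?_⟩
  · rcases le_or_gt 0 ϱ with hϱ | hϱ
    · exact le_mul_max_pow_of_recursion hϱ hq0 (fun h => hne (by rw [h])) hC3 hC.le hC0 hrec k
    · -- `ϱ < 0` forces a single profile, so the error vanishes and the bound is nonnegative
      have hzero : meanSqError P x xstar k = 0 := by
        have : ∀ ω, sqNorm (x k ω - xstar) = 0 := by
          intro ω
          by_contra hne'
          exact absurd (AggGame.contraction_pos_of_ne (α := α) hgrad hη (hx.mem_profiles k ω)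
            hstar.1 hne') hϱ.le.not_gt
        simp [meanSqError, this]
      have hmin : min (ϱ / q) (q / ϱ) ≤ 0 :=
        (min_le_left _ _).trans (div_nonpos_of_nonpos_of_nonneg hϱ.le hq0.le)
      have h1 : 0 < 1 - min (ϱ / q) (q / ϱ) := by linarith
      have h2 : 0 < max ϱ q := lt_max_of_lt_right hq0
      rw [hzero]
      positivity
  · have hqϱ : q = ϱ := by
      rwa [pow_left_inj₀ hq0.le hϱ.le two_ne_zero] at heq
    have hrec' : ∀ k, meanSqError P x xstar (k + 1) ≤ ϱ * meanSqError P x xstar k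
        + constC3 g.radius θ (q ^ 2) α ν Lᵢ * ϱ ^ (k + 1) := by
      intro k
      have h1 := hrec k
      rwa [show q ^ (k + 1) = ϱ ^ (k + 1) by rw [hqϱ]] at h1
    exact le_mul_pow_of_recursion_of_eq hϱ hϱ'.1 hC3 hC.le hC0 hrec' k
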